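/- **Theorem (strong consistency).** Let $d\ge 2$, let $\langle x,y\rangle_L=-x_0y_0+\sum_{j=1}^d x_jy_j$ be the Lorentz form on $\mathbb R^{d+1}$, and let $\mathbb H^d=\{x\in\mathbb R^{d+1}:\langle x,x\rangle_L=-1,\ x_0>0\}$ be hyperbolic space, with origin $o=(1,0,\dots,0)$ and distance $\rho(x,y)=\operatorname{arcosh}(-\langle x,y\rangle_L)$. Write $\operatorname{Exp}_\mu$, $\operatorname{Log}_\mu=\operatorname{Exp}_\mu^{-1}$ for the Riemannian exponential and logarithm maps at $\mu$, write $PT_{o\to\mu}:T_o\mathbb H^d\to T_\mu\mathbb H^d$ for parallel transport along the geodesic from $o$ to $\mu$, and identify $T_o\mathbb H^d$ with $\mathbb R^d$. Put $\mathsf T_\mu(x)=PT_{o\to\mu}^{-1}(\operatorname{Log}_\mu(x))\in\mathbb R^d$. Let $\mathcal S^{++}(d)$ be the set of symmetric positive definite real $d\times d$ matrices. For $\mu\in\mathbb H^d$ and $\Sigma\in\mathcal S^{++}(d)$, the hyperbolic wrapped normal distribution $\mathrm{HWN}_d(\mu,\Sigma)$ is the law of $\operatorname{Exp}_\mu(PT_{o\to\mu}Z)$,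 where $Z\sim N_d(0,\Sigma)$. Its log-density with respect to the hyperbolic volume is, up to the additive constant $-\tfrac d2\log(2\pi)$, $$m_{\mu,\Sigma}(x)=-\tfrac12\log\det\Sigma-\tfrac12\,\mathsf T_\mu(x)^\top\Sigma^{-1}\mathsf T_\mu(x)-(d-1)\,\varphi(\mathsf T_\mu(x)),\qquad \varphi(v)=\log\frac{\sinh\|v\|}{\|v\|}\ (v\ne0),\quad \varphi(0)=0.$$ Fix $0<\lambda_-<\lambda_+$ and let $\mathcal K=\{\Sigma\in\mathcal S^{++}(d):\lambda_-I\preceq\Sigma\preceq\lambda_+I\}$ be the eigenvalue shell, with interior $\operatorname{int}(\mathcal K)$ taken in $\mathcal S^{++}(d)$. Let $X_1,X_2,\dots$ be i.i.d. with law $\mathrm{HWN}_d(\mu_0,\Sigma_0)$, where $(\mu_0,\Sigma_0)\in\mathbb H^d\times\operatorname{int}(\mathcal K)$. For each $n\ge1$ let $(\hat\mu_n,\hat\Sigma_n)$ be any measurable shell-constrained maximizer of the likelihood, i.e. a random element of $\mathbb H^d\times\mathcal K$ that almost surely maximizes $\ell_n(\mu,\Sigma)=\sum_{i=1}^n m_{\mu,\Sigma}(X_i)$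 over $\mathbb H^d\times\mathcal K$. Then $$\hat\mu_n\to\mu_0,\qquad \hat\Sigma_n\to\Sigma_0\qquad\text{almost surely}.$$ Equivalently, in the Euclidean chart $\vartheta=(\alpha,\beta)$ given by $\alpha=\operatorname{Log}_{\mu_0}(\mu)\in T_{\mu_0}\mathbb H^d\cong\mathbb R^d$ and $\beta=\operatorname{vech}(\log\Sigma)\in\mathbb R^{d(d+1)/2}$, one has $\hat\vartheta_n\to\vartheta_0=(0,\operatorname{vech}(\log\Sigma_0))$ almost surely. -/

import Mathlib

open MeasureTheory ProbabilityTheory Filter Topology Matrix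

namespace HWN

/-! ### Hyperbolic space in the Lorentz model -/

/-- The Lorentz bilinear form `⟨x, y⟩ = -x₀ y₀ + ∑ⱼ xⱼ yⱼ` on `ℝ^{d+1}`. -/
def lor {d : ℕ} (x y : Fin (d + 1) → ℝ) : ℝ :=
  -(x 0 * y 0) + ∑ j : Fin d, x j.succ * y j.succ

section lor

variable {d : ℕ} (x y z : Fin (d + 1) → ℝ) (c : ℝ)

theorem lor_comm : lor x y = lor y x := by
  simp only [lor, mul_comm]

theorem lor_add_right : lor x (y + z) = lor x y + lor x z := by
  simp only [lor, Pi.add_apply, mul_add, Finset.sum_add_distrib]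
  ring

theorem lor_smul_right : lor x (c • y) = c * lor x y := by
  simp only [lor, Pi.smul_apply, smul_eq_mul, mul_add, Finset.mul_sum]
  congr 1
  · ring
  · exact Finset.sum_congr rfl fun j _ => by ring

theorem lor_add_left : lor (x + y) z = lor x z + lor y z := by
  rw [lor_comm, lor_add_right, lor_comm z x, lor_comm z y]

theorem lor_smul_left : lor (c • x) y = c * lor x y := by
  rw [lor_comm, lor_smul_right, lor_comm]

end lor

/-- Hyperbolic space `ℍ^d = {x ∈ ℝ^{d+1} : ⟨x, x⟩ = -1, x₀ > 0}`, with the topology and the Borel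
sets induced from `ℝ^{d+1}`. -/
abbrev Hyp (d : ℕ) : Type :=
  {x : Fin (d + 1) → ℝ // lor x x = -1 ∧ 0 < x 0}

/-- Reversed Cauchy-Schwarz inequality on the hyperboloid. -/
theorem lor_le_neg_one {d : ℕ} (x y : Hyp d) : lor x.1 y.1 ≤ -1 := by
  obtain ⟨x, hx, hx0⟩ := x
  obtain ⟨y, hy, hy0⟩ := y
  have hcs := Finset.sum_mul_sq_le_sq_mul_sq Finset.univ
    (fun j : Fin d => x j.succ) (fun j : Fin d => y j.succ)
  simp only [lor] at hx hy ⊢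
  have ex : ∑ j : Fin d, x j.succ ^ 2 = x 0 ^ 2 - 1 := by
    simp only [pow_two]; linarith
  have ey : ∑ j : Fin d, y j.succ ^ 2 = y 0 ^ 2 - 1 := by
    simp only [pow_two]; linarith
  rw [ex, ey] at hcs
  have hx1 : 1 ≤ x 0 := by
    have : 0 ≤ ∑ j : Fin d, x j.succ ^ 2 := Finset.sum_nonneg fun j _ => sq_nonneg _
    nlinarith
  have hy1 : 1 ≤ y 0 := by
    have : 0 ≤ ∑ j : Fin d, y j.succ ^ 2 := Finset.sum_nonneg fun j _ => sq_nonneg _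
    nlinarith
  have h1 : 1 ≤ x 0 * y 0 := by nlinarith
  have := abs_le_of_sq_le_sq' (b := x 0 * y 0 - 1)
    (a := ∑ j : Fin d, x j.succ * y j.succ) (by nlinarith [sq_nonneg (x 0 - y 0)]) (by linarith)
  linarith [this.2]

/-- The tangent space `T_x ℍ^d = {v ∈ ℝ^{d+1} : ⟨x, v⟩ = 0}`. -/
def tangent {d : ℕ} (x : Hyp d) : Submodule ℝ (Fin (d + 1) → ℝ) where
  carrier := {v | lor x.1 v = 0}
  add_mem' {a b} ha hb := by
    simp only [Set.mem_ofPred_eq] at ha hb ⊢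
    rw [lor_add_right, ha, hb, add_zero]
  zero_mem' := by simp [lor]
  smul_mem' c v hv := by
    simp only [Set.mem_ofPred_eq] at hv ⊢
    rw [lor_smul_right, hv, mul_zero]

theorem lor_tangent {d : ℕ} {x : Hyp d} (v : tangent x) : lor x.1 v.1 = 0 := v.2

/-- The Riemannian norm `‖v‖ = √⟨v, v⟩` of a tangent vector. -/
noncomputable def tnorm {d : ℕ} {x : Hyp d} (v : tangent x) : ℝ :=
  Real.sqrt (lor v.1 v.1)

/-- The Lorentz form is positive semidefinite on tangent spaces, quantitatively. -/
theorem tangent_time_sq_le {d : ℕ} {x : Hyp d} (v : tangent x) :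
    v.1 0 ^ 2 ≤ (x.1 0 ^ 2 - 1) * lor v.1 v.1 := by
  obtain ⟨x, hx, hx0⟩ := x
  obtain ⟨v, hv⟩ := v
  have hv' : lor x v = 0 := hv
  have hcs := Finset.sum_mul_sq_le_sq_mul_sq Finset.univ
    (fun j : Fin d => x j.succ) (fun j : Fin d => v j.succ)
  simp only [lor] at hx hv' ⊢
  have ex : ∑ j : Fin d, x j.succ ^ 2 = x 0 ^ 2 - 1 := by
    simp only [pow_two]; linarith
  have exv : ∑ j : Fin d, x j.succ * v j.succ = x 0 * v 0 := by linarith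
  have ev : ∑ j : Fin d, v j.succ * v j.succ = ∑ j : Fin d, v j.succ ^ 2 := by
    simp only [pow_two]
  rw [ex, exv] at hcs
  rw [ev]
  nlinarith

theorem lor_self_nonneg {d : ℕ} {x : Hyp d} (v : tangent x) : 0 ≤ lor v.1 v.1 := by
  have h := tangent_time_sq_le v
  by_contra hneg
  have hlt : lor v.1 v.1 < 0 := not_le.mp hneg
  have h0 : 0 ≤ x.1 0 ^ 2 - 1 := by
    have hx := x.2.1
    simp only [lor] at hx
    have : 0 ≤ ∑ j : Fin d, x.1 j.succ * x.1 j.succ :=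
      Finset.sum_nonneg fun j _ => mul_self_nonneg _
    nlinarith
  have hv0 : v.1 0 ^ 2 = 0 := le_antisymm (by nlinarith) (sq_nonneg _)
  have : 0 ≤ ∑ j : Fin d, v.1 j.succ * v.1 j.succ :=
    Finset.sum_nonneg fun j _ => mul_self_nonneg _
  simp only [lor] at hlt
  nlinarith

theorem tnorm_sq {d : ℕ} {x : Hyp d} (v : tangent x) : tnorm v ^ 2 = lor v.1 v.1 :=
  Real.sq_sqrt (lor_self_nonneg v)

/-- The hyperbolic distance `ρ(x, y) = arcosh(-⟨x, y⟩)`. -/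
noncomputable def rho {d : ℕ} (x y : Hyp d) : ℝ := Real.arcosh (-lor x.1 y.1)

/-- The origin `o = (1, 0, …, 0)`. -/
def origin (d : ℕ) : Hyp d :=
  ⟨Fin.cons 1 0, by simp [lor], by simp⟩

/-- The exponential map `Exp_μ(v) = cosh ‖v‖ μ + sinh ‖v‖ v / ‖v‖` (and `Exp_μ(0) = μ`, which the
formula gives since `0 / 0 = 0`). -/
noncomputable def expMap {d : ℕ} (μ : Hyp d) (v : tangent μ) : Hyp d :=
  ⟨Real.cosh (tnorm v) • μ.1 + (Real.sinh (tnorm v) / tnorm v) • v.1, by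
    have hμ := μ.2.1
    have hμ0 := μ.2.2
    have hv := lor_tangent v
    have hn := tnorm_sq v
    have hnn : 0 ≤ tnorm v := Real.sqrt_nonneg _
    have ht := tangent_time_sq_le v
    have hcs := Real.cosh_sq (tnorm v)
    rcases hnn.eq_or_lt with h0 | h0
    · rw [← h0]
      simpa using ⟨hμ, hμ0⟩
    constructor
    · simp only [lor_add_left, lor_add_right, lor_smul_left, lor_smul_right, hμ, hv,
        lor_comm v.1 μ.1, ← hn]
      field_simp
      nlinarith
    · simp only [Pi.add_apply, Pi.smul_apply, smul_eq_mul]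
      have hs : 0 < Real.sinh (tnorm v) := Real.sinh_pos_iff.mpr h0
      have hc : Real.sinh (tnorm v) < Real.cosh (tnorm v) := Real.sinh_lt_cosh _
      have habs := abs_le_of_sq_le_sq' (a := v.1 0) (b := μ.1 0 * tnorm v)
        (by rw [← hn] at ht; nlinarith [sq_nonneg (tnorm v)]) (by positivity)
      have h1 : -(μ.1 0) ≤ v.1 0 / tnorm v := by
        rw [le_div_iff₀ h0]; linarith [habs.1]
      have h2 : Real.sinh (tnorm v) / tnorm v * v.1 0
          = Real.sinh (tnorm v) * (v.1 0 / tnorm v) := by ring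
      rw [h2]
      nlinarith⟩

/-- The logarithm map
`Log_μ(x) = ρ(μ, x) / √((-⟨μ, x⟩)² - 1) (x + ⟨μ, x⟩ μ)`, with `Log_μ(μ) = 0`. -/
noncomputable def logMap {d : ℕ} (μ x : Hyp d) : tangent μ :=
  ⟨(rho μ x / Real.sqrt ((-lor μ.1 x.1) ^ 2 - 1)) • (x.1 + lor μ.1 x.1 • μ.1), by
    change lor _ _ = 0
    rw [lor_smul_right, lor_add_right, lor_smul_right, μ.2.1]
    ring⟩

theorem transport_mem {d : ℕ} (x y : Hyp d) (v : tangent x) :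
    v.1 + (lor y.1 v.1 / (1 - lor x.1 y.1)) • (x.1 + y.1) ∈ tangent y := by
  change lor _ _ = 0
  have h : 1 - lor x.1 y.1 ≠ 0 := by linarith [lor_le_neg_one x y]
  rw [lor_add_right, lor_smul_right, lor_add_right, y.2.1, lor_comm y.1 x.1]
  field_simp
  ring

theorem transport_inv {d : ℕ} (x y : Hyp d) (v : tangent x) (w : Fin (d + 1) → ℝ)
    (hw : w = v.1 + (lor y.1 v.1 / (1 - lor x.1 y.1)) • (x.1 + y.1)) :
    w + (lor x.1 w / (1 - lor y.1 x.1)) • (y.1 + x.1) = v.1 := by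
  have h : 1 - lor x.1 y.1 ≠ 0 := by linarith [lor_le_neg_one x y]
  have h1 : lor x.1 w = -lor y.1 v.1 := by
    rw [hw, lor_add_right, lor_smul_right, lor_add_right, x.2.1, lor_tangent v]
    field_simp
    ring
  rw [h1, lor_comm y.1 x.1, hw, add_comm y.1 x.1, add_assoc, ← add_smul]
  have : lor y.1 v.1 / (1 - lor x.1 y.1) + -lor y.1 v.1 / (1 - lor x.1 y.1) = 0 := by ring
  rw [this, zero_smul, add_zero]

/-- Parallel transport `PT_{x → y} : T_x ℍ^d → T_y ℍ^d` along the unique geodesic from `x` to `y`: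
`PT_{x → y}(v) = v + ⟨y, v⟩ / (1 - ⟨x, y⟩) (x + y)`, a linear isomorphism with inverse
`PT_{y → x}`.  See `transport_parallel` for the parallel transport equation. -/
noncomputable def transport {d : ℕ} (x y : Hyp d) : tangent x ≃ₗ[ℝ] tangent y where
  toFun v := ⟨v.1 + (lor y.1 v.1 / (1 - lor x.1 y.1)) • (x.1 + y.1), transport_mem x y v⟩
  invFun v := ⟨v.1 + (lor x.1 v.1 / (1 - lor y.1 x.1)) • (y.1 + x.1), transport_mem y x v⟩
  map_add' u v := by
    ext1
    simp only [Submodule.coe_add, lor_add_right, add_div, add_smul]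
    abel
  map_smul' c v := by
    ext1
    simp only [Submodule.coe_smul, lor_smul_right, RingHom.id_apply, smul_add, smul_smul,
      mul_div_assoc]
  left_inv v := by
    ext1
    exact transport_inv x y v _ rfl
  right_inv v := by
    ext1
    exact transport_inv y x v _ rfl

/-- `transport` is parallel transport: along the unit speed geodesic `t ↦ Exp_x(t u)` the field
`V(t) = PT_{x → Exp_x(t u)} v` has, as a curve in `ℝ^{d+1}`, a derivative that is Lorentz-normal to
the hyperboloid, i.e. `∇V = 0`; and `V(0) = v`. -/
theorem transport_parallel {d : ℕ} (x : Hyp d) (u v : tangent x) (hu : lor u.1 u.1 = 1) :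
    transport x (expMap x ((0 : ℝ) • u)) v = v.1 ∧
    ∀ t : ℝ, 0 ≤ t → ∃ c : ℝ,
      HasDerivWithinAt (fun s : ℝ => (transport x (expMap x (s • u)) v).1)
        (c • (expMap x (t • u)).1) (Set.Ici 0) t := by
  have hg : ∀ s : ℝ, 0 ≤ s →
      (expMap x (s • u)).1 = Real.cosh s • x.1 + Real.sinh s • u.1 := by
    intro s hs
    have hn : tnorm (s • u) = s := by
      simp [tnorm, lor_smul_left, lor_smul_right, hu, Real.sqrt_mul_self hs]
    simp only [expMap, hn, Submodule.coe_smul, smul_smul]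
    rcases hs.eq_or_lt with h | h
    · simp [← h]
    · rw [div_mul_cancel₀ _ h.ne']
  have hV : ∀ s : ℝ, 0 ≤ s → (transport x (expMap x (s • u)) v).1 =
      v.1 + lor u.1 v.1 • (Real.sinh s • x.1 + (Real.cosh s - 1) • u.1) := by
    intro s hs
    have h1 : lor (expMap x (s • u)).1 v.1 = Real.sinh s * lor u.1 v.1 := by
      rw [hg s hs, lor_add_left, lor_smul_left, lor_smul_left, lor_tangent v]; ring
    have h2 : lor x.1 (expMap x (s • u)).1 = -Real.cosh s := by
      rw [hg s hs, lor_add_right, lor_smul_right, lor_smul_right, lor_tangent u, x.2.1]; ring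
    have hc : 1 + Real.cosh s ≠ 0 := by linarith [Real.cosh_pos s]
    change v.1 + (lor (expMap x (s • u)).1 v.1 / (1 - lor x.1 (expMap x (s • u)).1)) •
      (x.1 + (expMap x (s • u)).1) = _
    rw [h1, h2, hg s hs]
    ext i
    simp only [Pi.add_apply, Pi.smul_apply, smul_eq_mul, sub_neg_eq_add]
    field_simp
    linear_combination (lor u.1 v.1 * u.1 i) * -(Real.cosh_sq s)
  refine ⟨by rw [hV 0 le_rfl]; simp, fun t ht => ⟨lor u.1 v.1, ?_⟩⟩
  rw [hg t ht]
  have hd : HasDerivAt (fun s : ℝ =>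
      v.1 + lor u.1 v.1 • (Real.sinh s • x.1 + (Real.cosh s - 1) • u.1))
      (lor u.1 v.1 • (Real.cosh t • x.1 + Real.sinh t • u.1)) t :=
    hasDerivAt_pi.2 fun i =>
      ((((Real.hasDerivAt_sinh t).mul_const (x.1 i)).add
        (((Real.hasDerivAt_cosh t).sub_const 1).mul_const (u.1 i))).const_mul _).const_add _
  exact hd.hasDerivWithinAt.congr (fun s hs => hV s hs) (hV t ht)

/-- The identification `ℝ^d ≅ T_o ℍ^d`, `v ↔ (0, v)`. -/
noncomputable def originFrame (d : ℕ) : EuclideanSpace ℝ (Fin d) ≃ₗ[ℝ] tangent (origin d) where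
  toFun v := ⟨Fin.cons 0 v.ofLp, by change lor _ _ = 0; simp [lor, origin]⟩
  invFun w := WithLp.toLp 2 fun j => w.1 j.succ
  map_add' u v := by
    ext i
    refine Fin.cases ?_ (fun j => ?_) i <;> simp
  map_smul' c v := by
    ext i
    refine Fin.cases ?_ (fun j => ?_) i <;> simp
  left_inv v := by ext j; simp
  right_inv w := by
    have h : w.1 0 = 0 := by simpa [lor, origin] using lor_tangent w
    ext i
    refine Fin.cases ?_ (fun j => ?_) i <;> simp [h]

/-- The tangent coordinate map `T_μ(x) = PT_{o → μ}⁻¹(Log_μ(x)) ∈ ℝ^d`. -/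
noncomputable def tcoord {d : ℕ} (μ x : Hyp d) : EuclideanSpace ℝ (Fin d) :=
  (originFrame d).symm ((transport (origin d) μ).symm (logMap μ x))

/-! ### The anisotropic hyperbolic wrapped normal distribution -/

/-- `S⁺⁺(d)`: symmetric positive definite real matrices, with the topology induced from the
space of matrices. -/
abbrev SPD (d : ℕ) : Type := {S : Matrix (Fin d) (Fin d) ℝ // S.PosDef}

/-- The Borel σ-algebra on `S⁺⁺(d)`. -/
instance instMeasurableSpaceSPD (d : ℕ) : MeasurableSpace (SPD d) := borel (SPD d)

/-- The wrapping map `z ↦ Exp_μ(PT_{o → μ} z)`, `ℝ^d → ℍ^d`. -/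
noncomputable def wrap {d : ℕ} (μ : Hyp d) (z : EuclideanSpace ℝ (Fin d)) : Hyp d :=
  expMap μ (transport (origin d) μ (originFrame d z))

theorem measurable_wrap {d : ℕ} (μ : Hyp d) : Measurable (wrap μ) := by
  have hlin : Measurable fun z : EuclideanSpace ℝ (Fin d) =>
      (transport (origin d) μ (originFrame d z)).1 :=
    (LinearMap.continuous_of_finiteDimensional
      ((tangent μ).subtype ∘ₗ (transport (origin d) μ).toLinearMap ∘ₗ
        (originFrame d).toLinearMap)).measurable
  have hc : ∀ i, Measurable fun z : EuclideanSpace ℝ (Fin d) =>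
      (transport (origin d) μ (originFrame d z)).1 i := fun i => measurable_pi_iff.mp hlin i
  have hn : Measurable fun z : EuclideanSpace ℝ (Fin d) =>
      tnorm (transport (origin d) μ (originFrame d z)) := by
    unfold tnorm lor
    exact ((((hc 0).mul (hc 0)).neg).add
      (Finset.measurable_sum _ fun j _ => (hc j.succ).mul (hc j.succ))).sqrt
  refine Measurable.subtype_mk ?_
  exact ((Real.measurable_cosh.comp hn).smul_const _).add
    (((Real.measurable_sinh.comp hn).div hn).smul hlin)

/-- The law `HWN_d(μ, Σ)` on `ℍ^d`: the distribution of `Exp_μ(PT_{o → μ} Z)`, `Z ∼ N_d(0, Σ)`. -/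
noncomputable def hwn {d : ℕ} (μ : Hyp d) (S : SPD d) : Measure (Hyp d) :=
  (multivariateGaussian 0 S.1).map (wrap μ)

/-! ### Likelihood and the covariance shell -/

/-- `φ(v) = log(sinh ‖v‖ / ‖v‖)` for `v ≠ 0`, and `φ(0) = 0`. -/
noncomputable def phi {d : ℕ} (v : EuclideanSpace ℝ (Fin d)) : ℝ :=
  open Classical in if v = 0 then 0 else Real.log (Real.sinh ‖v‖ / ‖v‖)

/-- The log-density `m_{μ,Σ}(x)` of a single observation, without the additive constant
`-(d/2) log(2π)`:
`-½ log det Σ - ½ T_μ(x)ᵀ Σ⁻¹ T_μ(x) - (d - 1) φ(T_μ(x))`. -/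
noncomputable def logDensity {d : ℕ} (θ : Hyp d × SPD d) (x : Hyp d) : ℝ :=
  -(1 / 2) * Real.log θ.2.1.det
    - (1 / 2) * ((tcoord θ.1 x).ofLp ⬝ᵥ (θ.2.1⁻¹ *ᵥ (tcoord θ.1 x).ofLp))
    - ((d : ℝ) - 1) * phi (tcoord θ.1 x)

/-- The sample log-likelihood `ℓ_n(μ, Σ) = ∑ᵢ m_{μ,Σ}(Xᵢ)`. -/
noncomputable def logLik {d n : ℕ} (x : Fin n → Hyp d) (θ : Hyp d × SPD d) : ℝ :=
  ∑ i, logDensity θ (x i)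

/-- The eigenvalue shell `𝒦 = {Σ ∈ S⁺⁺(d) : λ₋ I ≼ Σ ≼ λ₊ I}` (Loewner order). -/
def shell (d : ℕ) (lo hi : ℝ) : Set (SPD d) :=
  {S | (S.1 - lo • (1 : Matrix (Fin d) (Fin d) ℝ)).PosSemidef ∧
    (hi • (1 : Matrix (Fin d) (Fin d) ℝ) - S.1).PosSemidef}

/-- `θ = (μ, Σ)` is a shell-constrained maximizer of the likelihood of the sample `x`: it lies in
`Θ = ℍ^d × 𝒦` and maximizes `ℓ_n` over `Θ`. -/
def IsShellMLE {d n : ℕ} (lo hi : ℝ) (x : Fin n → Hyp d) (θ : Hyp d × SPD d) : Prop :=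
  θ.2 ∈ shell d lo hi ∧
    ∀ θ' : Hyp d × SPD d, θ'.2 ∈ shell d lo hi → logLik x θ' ≤ logLik x θ

/-! ### The Euclidean chart -/

/-- Half-vectorization: the entries of a matrix on and below the diagonal. -/
def vech {d : ℕ} (A : Matrix (Fin d) (Fin d) ℝ) : {p : Fin d × Fin d // p.2 ≤ p.1} → ℝ :=
  fun p => A p.1.1 p.1.2

/-- The Euclidean chart `ϑ = (α, β) ∈ ℝ^d × ℝ^{d(d+1)/2}` centred at `μ₀`: `α = Log_{μ₀}(μ)`, with
`T_{μ₀} ℍ^d ≅ ℝ^d` through parallel transport to `o`, and `β = vech(log Σ)`, with `log` the matrix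
logarithm (functional calculus of a symmetric matrix). -/
noncomputable def chart {d : ℕ} (μ₀ : Hyp d) (θ : Hyp d × SPD d) :
    EuclideanSpace ℝ (Fin d) × ({p : Fin d × Fin d // p.2 ≤ p.1} → ℝ) :=
  (tcoord μ₀ θ.1, vech (cfc Real.log θ.2.1))

end HWN

/-! This is Wald's argument. Maximizing the likelihood over the shell means minimizing the empirical
mean of a contrast `C - logDensity θ`, which is nonnegative for a suitable constant `C`. By Gibbs'
inequality the expected contrast is strictly smallest at the true parameter. Near any other
parameter, and for all base points far from the origin, the contrast has an integrable minorant with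
larger expectation. The strong law for countably many minorants then drives every minimizing
sequence to the truth, off a null set that does not depend on that sequence
(`tendsto_of_minimizes_contrast`).

Gibbs' inequality needs likelihood ratios of expectation one (`lintegral_likelihood_ratio`), hence
densities with respect to one reference measure for all base points. This measure is handled through
tangent coordinates: the image of `(sinh ‖z‖ / ‖z‖)^(d-1) dz` under `wrap μ` does not depend on `μ`
(`lintegral_wrap_eq`). Indeed `wrap μ` is, in spatial coordinates, a radial map followed by a
Lorentz boost. The radial map produces `dy / √(1 + ‖y‖²)`, which boosts preserve.

In the equality case, log-densities agreeing almost surely agree everywhere by continuity and full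
support. Then `μ` is recovered as the unique mode, and `Σ` from the quadratic form at that mode
(`eq_of_logDensity_ae_eq`).

The shell is compact, so only `μ` can escape. The contrast dominates `ρ(μ, x)² / (2 λ₊)` uniformly
over the shell (`exists_logDensity_le`), and this is large on a set of positive probability once `μ`
is far away (`exists_minorant_rho_sq`). Convergence in the chart is then a matter of continuity. -/

namespace HWN

/-! ### Wald's consistency theorem for minimum contrast estimators -/

section Wald

open scoped ENNReal

variable {𝒳 Θ : Type*}

/-- Around a parameter with larger expected contrast there is a neighbourhood on which the contrast
is bounded below by an integrable function with larger expectation. -/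
theorem exists_local_minorant [TopologicalSpace 𝒳] [MeasurableSpace 𝒳] [OpensMeasurableSpace 𝒳]
    [TopologicalSpace Θ] [FirstCountableTopology Θ] (Q : Measure 𝒳) [IsFiniteMeasure Q]
    {g : Θ → 𝒳 → ℝ} (hg0 : ∀ θ x, 0 ≤ g θ x) (hgx : ∀ θ, Continuous (g θ))
    (hgθ : ∀ x, Continuous fun θ => g θ x) {θ : Θ} {a : ℝ} (ha : 0 ≤ a)
    (hθ : ENNReal.ofReal a < ∫⁻ x, ENNReal.ofReal (g θ x) ∂Q) :
    ∃ U : Set Θ, IsOpen U ∧ θ ∈ U ∧ ∃ h : 𝒳 → ℝ, Measurable h ∧ Integrable h Q ∧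
      (∀ θ' ∈ U, ∀ x, h x ≤ g θ' x) ∧ a < ∫ x, h x ∂Q := by
  obtain ⟨U, hUo, hU⟩ := (nhds_basis_opens θ).exists_antitone_subbasis
  -- Infima over shrinking neighbourhoods increase to `g θ` by continuity in the parameter, so
  -- monotone convergence applies. The cap `k` makes each one integrable. An uncountable infimum of
  -- continuous functions is upper semicontinuous, hence measurable.
  let H : ℕ → 𝒳 → ℝ≥0∞ := fun k x => min k (⨅ θ' ∈ U k, ENNReal.ofReal (g θ' x))
  have hHm : ∀ k, Measurable (H k) := fun k =>
    measurable_const.min (UpperSemicontinuous.measurable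
      (upperSemicontinuous_biInf fun θ' _ =>
        (ENNReal.continuous_ofReal.comp (hgx θ')).upperSemicontinuous))
  have hHmono : Monotone H := fun i j hij x =>
    min_le_min (by exact_mod_cast hij)
      (biInf_mono fun θ' hθ' => hU.antitone hij hθ')
  have hHsup : ∀ x, ⨆ k, H k x = ENNReal.ofReal (g θ x) := by
    intro x
    refine le_antisymm (iSup_le fun k => (min_le_right _ _).trans
      (biInf_le _ (hUo k |>.1))) (le_of_forall_lt fun b hb => ?_)
    obtain ⟨c, hbc, hc⟩ := exists_between hb
    have hnear : ∀ᶠ θ' in 𝓝 θ, c < ENNReal.ofReal (g θ' x) :=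
      (ENNReal.continuous_ofReal.comp (hgθ x)).continuousAt.eventually (lt_mem_nhds hc)
    obtain ⟨k, hk⟩ := hU.mem_iff.1 hnear
    obtain ⟨m, hm⟩ := ENNReal.exists_nat_gt (hc.trans_le le_top).ne
    refine lt_of_lt_of_le hbc (le_trans ?_ (le_iSup (fun k => H k x) (max k m)))
    refine le_min (hm.le.trans (by exact_mod_cast le_max_right _ _)) (le_iInf₂ fun θ' hθ' => ?_)
    exact (hk (hU.antitone (le_max_left _ _) hθ')).le
  have hint : ⨆ k, ∫⁻ x, H k x ∂Q = ∫⁻ x, ENNReal.ofReal (g θ x) ∂Q := by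
    rw [← lintegral_iSup hHm hHmono]
    exact lintegral_congr hHsup
  rw [← hint] at hθ
  obtain ⟨k, hk⟩ := lt_iSup_iff.1 hθ
  have hfin : ∀ x, H k x ≠ ∞ := fun x =>
    ((min_le_left _ _).trans_lt (ENNReal.natCast_lt_top k)).ne
  have hlt : ∫⁻ x, H k x ∂Q ≠ ∞ := by
    refine ((lintegral_mono (g := fun _ => (k : ℝ≥0∞)) fun x => min_le_left _ _).trans_lt ?_).ne
    rw [lintegral_const]
    exact ENNReal.mul_lt_top (ENNReal.natCast_lt_top k) (measure_lt_top _ _)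
  refine ⟨U k, (hUo k).2, (hUo k).1, fun x => (H k x).toReal, (hHm k).ennreal_toReal,
    integrable_toReal_of_lintegral_ne_top (hHm k).aemeasurable hlt, fun θ' hθ' x => ?_, ?_⟩
  · refine ENNReal.toReal_le_of_le_ofReal (hg0 _ _) ((min_le_right _ _).trans (biInf_le _ hθ'))
  · rw [integral_toReal (hHm k).aemeasurable (ae_of_all _ fun x => (hfin x).lt_top)]
    exact (ENNReal.ofReal_lt_iff_lt_toReal ha hlt).1 hk

variable {Ω : Type*} [MeasurableSpace Ω] {P : Measure Ω}

/-- Strong law of large numbers for integrable functions of an i.i.d. sequence. -/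
theorem strong_law_of_hasLaw [MeasurableSpace 𝒳] {Q : Measure 𝒳} {X : ℕ → Ω → 𝒳}
    (hindep : iIndepFun X P) (hlaw : ∀ i, HasLaw (X i) Q P) {h : 𝒳 → ℝ} (hm : Measurable h)
    (hi : Integrable h Q) :
    ∀ᵐ ω ∂P, Tendsto (fun n : ℕ => (∑ i ∈ Finset.range n, h (X i ω)) / n) atTop
      (𝓝 (∫ x, h x ∂Q)) := by
  have hid : ∀ i, IdentDistrib (h ∘ X i) (h ∘ X 0) P P := fun i =>
    (IdentDistrib.mk (hlaw i).aemeasurable (hlaw 0).aemeasurable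
      ((hlaw i).map_eq.trans (hlaw 0).map_eq.symm)).comp hm
  have := strong_law_ae_real (fun i => h ∘ X i)
    (by
      have : Integrable h (P.map (X 0)) := by rwa [(hlaw 0).map_eq]
      exact this.comp_aemeasurable (hlaw 0).aemeasurable)
    (fun i j hij => (hindep.indepFun hij).comp hm hm) hid
  rwa [show P[h ∘ X 0] = ∫ x, h x ∂Q by
    rw [← (hlaw 0).map_eq, integral_map (hlaw 0).aemeasurable hm.aestronglyMeasurable]; rfl] at this

/-- If the contrast is bounded below on `U` by a function whose expectation exceeds that of the
contrast at `θ₀`, then minimizers of the empirical contrast eventually leave `U`. -/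
theorem eventually_notMem_of_minorant [MeasurableSpace 𝒳] {Q : Measure 𝒳} {X : ℕ → Ω → 𝒳}
    (hindep : iIndepFun X P) (hlaw : ∀ i, HasLaw (X i) Q P) {g : Θ → 𝒳 → ℝ} {θ₀ : Θ}
    (hm₀ : Measurable (g θ₀)) (hi₀ : Integrable (g θ₀) Q) {U : Set Θ} {h : 𝒳 → ℝ}
    (hm : Measurable h) (hi : Integrable h Q) (hU : ∀ θ ∈ U, ∀ x, h x ≤ g θ x)
    (hlt : ∫ x, g θ₀ x ∂Q < ∫ x, h x ∂Q) :
    ∀ᵐ ω ∂P, ∀ θhat : ℕ → Θ,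
      (∀ᶠ n in atTop, ∑ i ∈ Finset.range n, g (θhat n) (X i ω)
        ≤ ∑ i ∈ Finset.range n, g θ₀ (X i ω)) →
      ∀ᶠ n in atTop, θhat n ∉ U := by
  filter_upwards [strong_law_of_hasLaw hindep hlaw hm hi,
    strong_law_of_hasLaw hindep hlaw hm₀ hi₀] with ω h1 h2 θhat hmin
  filter_upwards [h2.eventually_lt h1 hlt, hmin, eventually_gt_atTop 0] with n hn hle hpos hmem
  have hpos' : (0 : ℝ) < n := by exact_mod_cast hpos
  have := (div_lt_div_iff_of_pos_right hpos').1 hn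
  have h3 : ∑ i ∈ Finset.range n, h (X i ω) ≤ ∑ i ∈ Finset.range n, g (θhat n) (X i ω) :=
    Finset.sum_le_sum fun i _ => hU _ hmem _
  linarith

/-- **Wald's theorem**: strong consistency of minimum contrast estimators. -/
theorem tendsto_of_minimizes_contrast [TopologicalSpace 𝒳] [MeasurableSpace 𝒳]
    [OpensMeasurableSpace 𝒳] [TopologicalSpace Θ] [SecondCountableTopology Θ]
    {Q : Measure 𝒳} [IsFiniteMeasure Q] {X : ℕ → Ω → 𝒳}
    (hindep : iIndepFun X P) (hlaw : ∀ i, HasLaw (X i) Q P)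
    {g : Θ → 𝒳 → ℝ} (hg0 : ∀ θ x, 0 ≤ g θ x) (hgx : ∀ θ, Continuous (g θ))
    (hgθ : ∀ x, Continuous fun θ => g θ x) {θ₀ : Θ} (hi₀ : Integrable (g θ₀) Q)
    (hsep : ∀ θ, θ ≠ θ₀ →
      ∫⁻ x, ENNReal.ofReal (g θ₀ x) ∂Q < ∫⁻ x, ENNReal.ofReal (g θ x) ∂Q)
    {K : Set Θ} (hK : IsCompact K) {h : 𝒳 → ℝ} (hm : Measurable h) (hi : Integrable h Q)
    (hKh : ∀ θ ∉ K, ∀ x, h x ≤ g θ x) (hlt : ∫ x, g θ₀ x ∂Q < ∫ x, h x ∂Q) :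
    ∀ᵐ ω ∂P, ∀ θhat : ℕ → Θ,
      (∀ᶠ n in atTop, ∑ i ∈ Finset.range n, g (θhat n) (X i ω)
        ≤ ∑ i ∈ Finset.range n, g θ₀ (X i ω)) →
      Tendsto θhat atTop (𝓝 θ₀) := by
  have hloc : ∀ θ : {θ // θ ≠ θ₀}, ∃ U : Set Θ, IsOpen U ∧ θ.1 ∈ U ∧ ∃ h : 𝒳 → ℝ,
      Measurable h ∧ Integrable h Q ∧ (∀ θ' ∈ U, ∀ x, h x ≤ g θ' x) ∧
      ∫ x, g θ₀ x ∂Q < ∫ x, h x ∂Q := fun θ =>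
    exists_local_minorant Q hg0 hgx hgθ (integral_nonneg (hg0 θ₀))
      (by rw [ofReal_integral_eq_lintegral_ofReal hi₀ (ae_of_all _ (hg0 θ₀))]; exact hsep _ θ.2)
  choose U hUo hUmem hU using hloc
  -- Lindelöf: countably many neighbourhoods cover everything except `θ₀`, so the exceptional null
  -- sets can be united.
  obtain ⟨T, hTc, hT⟩ := TopologicalSpace.isOpen_iUnion_countable U hUo
  have hout := eventually_notMem_of_minorant hindep hlaw (hgx θ₀).measurable hi₀
    (U := Kᶜ) hm hi hKh hlt
  have hall : ∀ᵐ ω ∂P, ∀ θ ∈ T, ∀ θhat : ℕ → Θ,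
      (∀ᶠ n in atTop, ∑ i ∈ Finset.range n, g (θhat n) (X i ω)
        ≤ ∑ i ∈ Finset.range n, g θ₀ (X i ω)) →
      ∀ᶠ n in atTop, θhat n ∉ U θ := by
    refine (ae_ball_iff hTc).2 fun θ _ => ?_
    obtain ⟨h', hm', hi', hle', hlt'⟩ := hU θ
    exact eventually_notMem_of_minorant hindep hlaw (hgx θ₀).measurable hi₀ hm' hi' hle' hlt'
  filter_upwards [hout, hall] with ω h1 h2 θhat hmin
  -- A sequence eventually in a compact set converges once `θ₀` is its only possible cluster point.
  refine hK.tendsto_nhds_of_unique_mapClusterPt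
    ((h1 θhat hmin).mono fun n hn => not_not.1 hn) fun θ _ hcl => ?_
  by_contra hne
  have hmem : θ ∈ ⋃ i ∈ T, U i := by
    rw [hT]; exact Set.mem_iUnion.2 ⟨⟨θ, hne⟩, hUmem ⟨θ, hne⟩⟩
  obtain ⟨i, hi, hmem⟩ := Set.mem_iUnion₂.1 hmem
  exact (hcl.frequently ((hUo i).mem_nhds hmem)) (h2 i hi θhat hmin)

end Wald

/-! ### The density of the multivariate Gaussian distribution -/

section Gaussian

variable {d : ℕ}

theorem pi_gaussianReal_eq_withDensity :
    Measure.pi (fun _ : Fin d => gaussianReal 0 1) =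
      volume.withDensity fun x : Fin d → ℝ =>
        ENNReal.ofReal (Real.exp (-(d / 2 * Real.log (2 * Real.pi)) - (1 / 2) * ∑ i, x i ^ 2)) := by
  have hdens : ∀ x : Fin d → ℝ,
      Real.exp (-(d / 2 * Real.log (2 * Real.pi)) - (1 / 2) * ∑ i, x i ^ 2)
        = ∏ i, gaussianPDFReal 0 1 (x i) := by
    intro x
    have h1 : ∀ y : ℝ, gaussianPDFReal 0 1 y
        = Real.exp (-(1 / 2 * Real.log (2 * Real.pi)) - (1 / 2) * y ^ 2) := by
      intro y
      have hpi : (0 : ℝ) < 2 * Real.pi := by positivity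
      rw [gaussianPDFReal, Real.exp_sub, Real.exp_neg,
        show 1 / 2 * Real.log (2 * Real.pi) = Real.log (√(2 * Real.pi)) by
          rw [Real.log_sqrt hpi.le]; ring, Real.exp_log (by positivity), div_eq_mul_inv (√_)⁻¹,
        ← Real.exp_neg (1 / 2 * y ^ 2)]
      simp only [NNReal.coe_one, mul_one, sub_zero]
      congr 2
      ring
    simp_rw [h1, ← Real.exp_sum, Finset.sum_sub_distrib, Finset.mul_sum]
    simp
    ring
  refine Measure.pi_eq fun s hs => ?_
  rw [withDensity_apply _ (MeasurableSet.univ_pi hs)]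
  simp_rw [hdens]
  rw [volume_pi, Measure.restrict_pi_pi, ← ofReal_integral_eq_lintegral_ofReal]
  · rw [integral_fintype_prod_eq_prod, ENNReal.ofReal_prod_of_nonneg]
    · refine Finset.prod_congr rfl fun i _ => ?_
      rw [gaussianReal_apply_eq_integral 0 one_ne_zero]
    · exact fun i _ => integral_nonneg fun x => gaussianPDFReal_nonneg _ _ _
  · exact Integrable.fintype_prod fun i => (integrable_gaussianPDFReal 0 1).restrict
  · exact ae_of_all _ fun x => Finset.prod_nonneg fun i _ => gaussianPDFReal_nonneg _ _ _

theorem lintegral_stdGaussian (f : EuclideanSpace ℝ (Fin d) → ENNReal) (hf : Measurable f) :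
    ∫⁻ z, f z ∂(stdGaussian (EuclideanSpace ℝ (Fin d))) =
      ∫⁻ z, ENNReal.ofReal
        (Real.exp (-(d / 2 * Real.log (2 * Real.pi)) - (1 / 2) * ‖z‖ ^ 2)) * f z := by
  rw [← map_pi_eq_stdGaussian, lintegral_map hf (by fun_prop), pi_gaussianReal_eq_withDensity,
    lintegral_withDensity_eq_lintegral_mul _ (by fun_prop) (by fun_prop),
    ← (PiLp.volume_preserving_toLp (Fin d)).lintegral_comp (by fun_prop)]
  refine lintegral_congr fun x => ?_
  simp [EuclideanSpace.real_norm_sq_eq]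

open scoped MatrixOrder in
/-- The density of `N_d(0, S)` with respect to Lebesgue measure. -/
theorem lintegral_multivariateGaussian {S : Matrix (Fin d) (Fin d) ℝ} (hS : S.PosDef)
    (f : EuclideanSpace ℝ (Fin d) → ENNReal) (hf : Measurable f) :
    ∫⁻ z, f z ∂(multivariateGaussian 0 S) =
      ∫⁻ z, ENNReal.ofReal (Real.exp (-(d / 2 * Real.log (2 * Real.pi))
        - (1 / 2) * Real.log S.det - (1 / 2) * (z.ofLp ⬝ᵥ (S⁻¹ *ᵥ z.ofLp)))) * f z := by
  -- `N(0, S)` is the image of the standard Gaussian under `√S`, so its density comes from a linear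
  -- change of variables with Jacobian `|det B| = √(det S)`.
  set B := CFC.sqrt S with hB
  have hBB : B * B = S := CFC.sqrt_mul_sqrt_self S hS.posSemidef.nonneg
  have hBT : Bᵀ = B := by
    have : IsSelfAdjoint B := (CFC.sqrt_nonneg S).isSelfAdjoint
    simpa [IsSelfAdjoint, star_eq_conjTranspose, conjTranspose_eq_transpose_of_trivial] using this
  have hdet : B.det ^ 2 = S.det := by rw [← hBB, det_mul, sq]
  have hdet0 : B.det ≠ 0 := fun h => hS.det_pos.ne' (by rw [← hdet, h]; simp)
  have hBu : IsUnit B.det := isUnit_iff_ne_zero.2 hdet0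
  have hinv : B * S⁻¹ * B = 1 := by
    rw [← hBB, Matrix.mul_inv_rev, ← Matrix.mul_assoc, Matrix.mul_nonsing_inv _ hBu,
      Matrix.one_mul, Matrix.nonsing_inv_mul _ hBu]
  let A : EuclideanSpace ℝ (Fin d) →L[ℝ] EuclideanSpace ℝ (Fin d) := toEuclideanCLM (𝕜 := ℝ) B
  have hA : ∀ z, (A z).ofLp = B *ᵥ z.ofLp := fun z => ofLp_toEuclideanCLM B z
  have hAdet : LinearMap.det (A : EuclideanSpace ℝ (Fin d) →ₗ[ℝ] EuclideanSpace ℝ (Fin d))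
      = B.det := by
    rw [← LinearMap.det_toLin (EuclideanSpace.basisFun (Fin d) ℝ).toBasis B]
    rfl
  have hq : ∀ z, (A z).ofLp ⬝ᵥ (S⁻¹ *ᵥ (A z).ofLp) = ‖z‖ ^ 2 := by
    intro z
    have h1 : B *ᵥ z.ofLp ⬝ᵥ (S⁻¹ *ᵥ (B *ᵥ z.ofLp)) = z.ofLp ⬝ᵥ (B * S⁻¹ * B) *ᵥ z.ofLp := by
      rw [← mulVec_mulVec, ← mulVec_mulVec, dotProduct_mulVec z.ofLp B, ← mulVec_transpose, hBT]
    rw [hA, h1, hinv, one_mulVec, EuclideanSpace.real_norm_sq_eq]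
    simp [dotProduct, sq]
  have hlog : Real.exp (-((1 / 2) * Real.log S.det)) = |B.det|⁻¹ := by
    rw [← hdet, ← sq_abs, Real.log_pow, Real.exp_neg]
    congr 1
    rw [← Real.exp_log (abs_pos.2 hdet0)]
    simp
  rw [multivariateGaussian]
  simp only [zero_add]
  rw [lintegral_map hf (by fun_prop), lintegral_stdGaussian _ (by fun_prop)]
  set F : EuclideanSpace ℝ (Fin d) → ENNReal := fun w =>
    ENNReal.ofReal (Real.exp (-(d / 2 * Real.log (2 * Real.pi))
      - (1 / 2) * (w.ofLp ⬝ᵥ (S⁻¹ *ᵥ w.ofLp)))) * f w with hF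
  have hmq : Measurable fun w : EuclideanSpace ℝ (Fin d) => w.ofLp ⬝ᵥ (S⁻¹ *ᵥ w.ofLp) := by
    have : Continuous fun w : EuclideanSpace ℝ (Fin d) => w.ofLp ⬝ᵥ (S⁻¹ *ᵥ w.ofLp) := by
      fun_prop
    exact this.measurable
  have hFm : Measurable F := by fun_prop
  calc _ = ∫⁻ z, F (A z) := by
        refine lintegral_congr fun z => ?_
        rw [hF]
        simp only [hq]
        rfl
    _ = ∫⁻ w, F w ∂((volume : Measure (EuclideanSpace ℝ (Fin d))).map A) :=
        (lintegral_map hFm A.continuous.measurable).symm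
    _ = ENNReal.ofReal |B.det|⁻¹ * ∫⁻ w, F w := by
        have := Measure.map_linearMap_addHaar_eq_smul_addHaar
          (volume : Measure (EuclideanSpace ℝ (Fin d))) (f := A.toLinearMap) (by rwa [hAdet])
        rw [ContinuousLinearMap.coe_coe] at this
        rw [this, lintegral_smul_measure, hAdet, abs_inv, smul_eq_mul]
    _ = _ := by
        rw [← lintegral_const_mul _ hFm]
        refine lintegral_congr fun w => ?_
        rw [hF, ← mul_assoc, ← ENNReal.ofReal_mul (by positivity), ← hlog, ← Real.exp_add]
        congr 3
        ring

end Gaussian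

/-! ### Exponential, logarithm and parallel transport -/

section Geometry

open scoped RealInnerProductSpace

variable {d : ℕ}

theorem tnorm_nonneg {x : Hyp d} (v : tangent x) : 0 ≤ tnorm v := Real.sqrt_nonneg _

/-- The form is definite on tangent spaces: `tangent_time_sq_le` kills the time coordinate, and a
sum of squares remains. -/
theorem tnorm_eq_zero {x : Hyp d} {v : tangent x} (h : tnorm v = 0) : v = 0 := by
  have h0 : lor v.1 v.1 = 0 := by rw [← tnorm_sq, h]; simp
  have ht : v.1 0 = 0 := by
    have := tangent_time_sq_le v
    rw [h0, mul_zero] at this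
    exact pow_eq_zero_iff two_ne_zero |>.1 (le_antisymm this (sq_nonneg _))
  have hs : ∑ j : Fin d, v.1 j.succ * v.1 j.succ = 0 := by simpa [lor, ht] using h0
  rw [Finset.sum_eq_zero_iff_of_nonneg fun j _ => mul_self_nonneg _] at hs
  ext i
  refine Fin.cases ht (fun j => ?_) i
  simpa using hs j (Finset.mem_univ j)

theorem tnorm_smul {x : Hyp d} {c : ℝ} (hc : 0 ≤ c) (v : tangent x) :
    tnorm (c • v) = c * tnorm v := by
  rw [tnorm, tnorm, Submodule.coe_smul, lor_smul_left, lor_smul_right, ← mul_assoc,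
    Real.sqrt_mul (mul_self_nonneg c), Real.sqrt_mul_self hc]

theorem tnorm_transport (x y : Hyp d) (v : tangent x) : tnorm (transport x y v) = tnorm v := by
  have h : 1 - lor x.1 y.1 ≠ 0 := by linarith [lor_le_neg_one x y]
  rw [tnorm, tnorm]
  congr 1
  change lor (v.1 + (lor y.1 v.1 / (1 - lor x.1 y.1)) • (x.1 + y.1))
    (v.1 + (lor y.1 v.1 / (1 - lor x.1 y.1)) • (x.1 + y.1)) = _
  simp only [lor_add_left, lor_add_right, lor_smul_left, lor_smul_right, x.2.1, y.2.1,
    lor_tangent v, lor_comm v.1 x.1, lor_comm v.1 y.1, lor_comm y.1 x.1]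
  field_simp
  ring

theorem tnorm_originFrame (z : EuclideanSpace ℝ (Fin d)) : tnorm (originFrame d z) = ‖z‖ := by
  rw [tnorm, EuclideanSpace.norm_eq]
  congr 1
  simp [originFrame, lor, sq]

theorem tnorm_transport_originFrame (μ : Hyp d) (z : EuclideanSpace ℝ (Fin d)) :
    tnorm (transport (origin d) μ (originFrame d z)) = ‖z‖ := by
  rw [tnorm_transport, tnorm_originFrame]

theorem one_le_neg_lor (x y : Hyp d) : 1 ≤ -lor x.1 y.1 := by linarith [lor_le_neg_one x y]

theorem rho_nonneg (x y : Hyp d) : 0 ≤ rho x y := Real.arcosh_nonneg (one_le_neg_lor x y)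

theorem cosh_rho (x y : Hyp d) : Real.cosh (rho x y) = -lor x.1 y.1 :=
  Real.cosh_arcosh (one_le_neg_lor x y)

theorem sinh_rho (x y : Hyp d) : Real.sinh (rho x y) = √((-lor x.1 y.1) ^ 2 - 1) :=
  Real.sinh_arcosh (one_le_neg_lor x y)

/-- The normal component `x + ⟨μ, x⟩ μ` of `x`, as a tangent vector at `μ`. -/
def tangentProj (μ x : Hyp d) : tangent μ :=
  ⟨x.1 + lor μ.1 x.1 • μ.1, by
    change lor _ _ = 0
    rw [lor_add_right, lor_smul_right, μ.2.1]
    ring⟩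

theorem logMap_eq_smul (μ x : Hyp d) :
    logMap μ x = (rho μ x / Real.sinh (rho μ x)) • tangentProj μ x := by
  rw [sinh_rho]; rfl

theorem tnorm_tangentProj (μ x : Hyp d) : tnorm (tangentProj μ x) = Real.sinh (rho μ x) := by
  rw [sinh_rho, tnorm]
  congr 1
  change lor (x.1 + lor μ.1 x.1 • μ.1) (x.1 + lor μ.1 x.1 • μ.1) = _
  simp only [lor_add_left, lor_add_right, lor_smul_left, lor_smul_right, x.2.1, μ.2.1,
    lor_comm x.1 μ.1]
  ring

theorem tnorm_logMap (μ x : Hyp d) : tnorm (logMap μ x) = rho μ x := by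
  rw [logMap_eq_smul, tnorm_smul, tnorm_tangentProj]
  · rcases (rho_nonneg μ x).eq_or_lt with h | h
    · simp [← h]
    · exact div_mul_cancel₀ _ (Real.sinh_pos_iff.2 h).ne'
  · exact div_nonneg (rho_nonneg _ _) (Real.sinh_nonneg_iff.2 (rho_nonneg _ _))

theorem expMap_logMap (μ x : Hyp d) : expMap μ (logMap μ x) = x := by
  ext1
  change Real.cosh (tnorm (logMap μ x)) • μ.1
    + (Real.sinh (tnorm (logMap μ x)) / tnorm (logMap μ x)) • (logMap μ x).1 = x.1
  rw [tnorm_logMap, cosh_rho, logMap_eq_smul, Submodule.coe_smul, smul_smul]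
  rcases (rho_nonneg μ x).eq_or_lt with h | h
  · have hz : tangentProj μ x = 0 := tnorm_eq_zero (by rw [tnorm_tangentProj, ← h, Real.sinh_zero])
    have hz' : x.1 + lor μ.1 x.1 • μ.1 = 0 := congrArg Subtype.val hz
    rw [hz, Submodule.coe_zero, smul_zero, add_zero, neg_smul]
    exact (eq_neg_of_add_eq_zero_left hz').symm
  · have hs := (Real.sinh_pos_iff.2 h).ne'
    rw [show Real.sinh (rho μ x) / rho μ x * (rho μ x / Real.sinh (rho μ x)) = 1 by
      field_simp, one_smul]
    change -lor μ.1 x.1 • μ.1 + (x.1 + lor μ.1 x.1 • μ.1) = x.1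
    rw [neg_smul]
    abel

theorem lor_expMap (μ : Hyp d) (v : tangent μ) :
    lor μ.1 (expMap μ v).1 = -Real.cosh (tnorm v) := by
  change lor μ.1 (Real.cosh (tnorm v) • μ.1 + (Real.sinh (tnorm v) / tnorm v) • v.1) = _
  rw [lor_add_right, lor_smul_right, lor_smul_right, lor_tangent v, μ.2.1]
  ring

theorem rho_expMap (μ : Hyp d) (v : tangent μ) : rho μ (expMap μ v) = tnorm v := by
  rw [rho, lor_expMap, neg_neg, Real.arcosh_cosh (tnorm_nonneg v)]

theorem logMap_expMap (μ : Hyp d) (v : tangent μ) : logMap μ (expMap μ v) = v := by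
  rcases (tnorm_nonneg v).eq_or_lt with h | h
  · have h0 : tnorm (logMap μ (expMap μ v)) = 0 := by rw [tnorm_logMap, rho_expMap, ← h]
    rw [tnorm_eq_zero h0, tnorm_eq_zero h.symm]
  · have hs := (Real.sinh_pos_iff.2 h).ne'
    rw [logMap_eq_smul, rho_expMap]
    ext1
    rw [Submodule.coe_smul]
    change (tnorm v / Real.sinh (tnorm v)) •
      ((Real.cosh (tnorm v) • μ.1 + (Real.sinh (tnorm v) / tnorm v) • v.1)
        + lor μ.1 (expMap μ v).1 • μ.1) = v.1
    rw [lor_expMap, neg_smul, add_right_comm, add_neg_cancel, zero_add, smul_smul]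
    rw [show tnorm v / Real.sinh (tnorm v) * (Real.sinh (tnorm v) / tnorm v) = 1 by
      field_simp, one_smul]

theorem tcoord_wrap (μ : Hyp d) (z : EuclideanSpace ℝ (Fin d)) : tcoord μ (wrap μ z) = z := by
  simp [tcoord, wrap, logMap_expMap]

theorem wrap_tcoord (μ x : Hyp d) : wrap μ (tcoord μ x) = x := by
  simp [tcoord, wrap, expMap_logMap]

theorem norm_tcoord (μ x : Hyp d) : ‖tcoord μ x‖ = rho μ x := by
  rw [← tnorm_transport_originFrame μ, ← tnorm_logMap]
  simp [tcoord]

theorem rho_self (x : Hyp d) : rho x x = 0 := by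
  simp [rho, x.2.1]

theorem tcoord_self (x : Hyp d) : tcoord x x = 0 := by
  rw [← norm_eq_zero, norm_tcoord, rho_self]

theorem eq_of_rho_eq_zero {x y : Hyp d} (h : rho x y = 0) : x = y := by
  have h1 : tcoord x y = 0 := by rw [← norm_eq_zero, norm_tcoord, h]
  rw [← wrap_tcoord x y, h1, ← tcoord_self x, wrap_tcoord]

/-! ### Continuity of the tangent coordinate map -/

theorem continuous_lor : Continuous fun p : Hyp d × Hyp d => lor p.1.1 p.2.1 := by
  have : Continuous fun p : (Fin (d + 1) → ℝ) × (Fin (d + 1) → ℝ) => lor p.1 p.2 := by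
    unfold lor
    fun_prop
  exact this.comp ((continuous_subtype_val.comp continuous_fst).prodMk
    (continuous_subtype_val.comp continuous_snd))

theorem continuous_rho : Continuous fun p : Hyp d × Hyp d => rho p.1 p.2 :=
  Real.continuousOn_arcosh.comp_continuous continuous_lor.neg fun p => one_le_neg_lor p.1 p.2

/-- This is the rational part of `tcoord`. Its only denominator, `1 - ⟨μ, o⟩`, is at least 2. -/
theorem continuous_transport_tangentProj : Continuous fun p : Hyp d × Hyp d =>
    (originFrame d).symm ((transport (origin d) p.1).symm (tangentProj p.1 p.2)) := by
  have hpos : ∀ p : Hyp d × Hyp d, 1 - lor p.1.1 (origin d).1 ≠ 0 := fun p => by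
    linarith [lor_le_neg_one p.1 (origin d)]
  refine (PiLp.continuous_toLp 2 _).comp (continuous_pi fun j => ?_)
  change Continuous fun p : Hyp d × Hyp d => (p.2.1 + lor p.1.1 p.2.1 • p.1.1) j.succ +
    (lor (origin d).1 (p.2.1 + lor p.1.1 p.2.1 • p.1.1) / (1 - lor p.1.1 (origin d).1)) *
      (p.1.1 + (origin d).1) j.succ
  have h1 : Continuous fun p : Hyp d × Hyp d => p.2.1 + lor p.1.1 p.2.1 • p.1.1 :=
    (continuous_subtype_val.comp continuous_snd).add
      (continuous_lor.smul (continuous_subtype_val.comp continuous_fst))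
  have h2 : Continuous fun p : Hyp d × Hyp d =>
      lor (origin d).1 (p.2.1 + lor p.1.1 p.2.1 • p.1.1) := by
    have : Continuous fun v : Fin (d + 1) → ℝ => lor (origin d).1 v := by
      unfold lor
      fun_prop
    exact this.comp h1
  have h3 : Continuous fun p : Hyp d × Hyp d => 1 - lor p.1.1 (origin d).1 :=
    continuous_const.sub (continuous_lor.comp (continuous_fst.prodMk continuous_const))
  exact ((continuous_apply _).comp h1).add ((h2.div h3 hpos).mul
    ((continuous_apply _).comp ((continuous_subtype_val.comp continuous_fst).add continuous_const)))

theorem tcoord_eq_smul (μ x : Hyp d) : tcoord μ x = (rho μ x / Real.sinh (rho μ x)) •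
    (originFrame d).symm ((transport (origin d) μ).symm (tangentProj μ x)) := by
  rw [tcoord, logMap_eq_smul, map_smul, map_smul]

/-- The scalar `ρ / sinh ρ` reads `0 / 0` on the diagonal. There continuity follows from `‖tcoord‖ =
ρ` instead. -/
theorem continuous_tcoord : Continuous fun p : Hyp d × Hyp d => tcoord p.1 p.2 := by
  rw [continuous_iff_continuousAt]
  intro p
  by_cases h : rho p.1 p.2 = 0
  · have h0 : tcoord p.1 p.2 = 0 := by rw [← norm_eq_zero, norm_tcoord, h]
    rw [ContinuousAt, h0, tendsto_zero_iff_norm_tendsto_zero]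
    simp_rw [norm_tcoord]
    simpa [h] using continuous_rho.tendsto p
  · simp_rw [tcoord_eq_smul]
    refine ContinuousAt.smul (ContinuousAt.div continuous_rho.continuousAt
      (Real.continuous_sinh.comp continuous_rho).continuousAt ?_)
      continuous_transport_tangentProj.continuousAt
    simpa using h

end Geometry

/-! ### The hyperbolic volume in tangent coordinates -/

section Volume

open scoped RealInnerProductSpace

/-! ### Boosts and the radial map in an inner product space -/

section InnerProduct

variable {E : Type*} [NormedAddCommGroup E]

/-- The time coordinate `√(1 + ‖y‖²)` of the point of the hyperboloid above `y`. -/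
noncomputable def height (y : E) : ℝ := √(1 + ‖y‖ ^ 2)

theorem height_sq (y : E) : height y ^ 2 = 1 + ‖y‖ ^ 2 := Real.sq_sqrt (by positivity)

theorem height_pos (y : E) : 0 < height y := Real.sqrt_pos.2 (by positivity)

theorem height_neg (y : E) : height (-y) = height y := by simp [height]

variable [InnerProductSpace ℝ E]

/-- The Lorentz boost by `m`, in spatial coordinates. -/
noncomputable def boost (m y : E) : E := y + (⟪m, y⟫ / (1 + height m) + height y) • m

theorem height_mul_height_add_inner_pos (m y : E) : 0 < height m * height y + ⟪m, y⟫ := by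
  have h1 := abs_le.1 (abs_real_inner_le_norm m y)
  have h2 : ‖m‖ < height m := Real.lt_sqrt_of_sq_lt (by linarith)
  have h3 : ‖y‖ < height y := Real.lt_sqrt_of_sq_lt (by linarith)
  nlinarith [norm_nonneg m, norm_nonneg y, height_pos m, height_pos y]

theorem height_boost (m y : E) : height (boost m y) = height m * height y + ⟪m, y⟫ := by
  rw [height, boost, Real.sqrt_eq_iff_mul_self_eq (by positivity)
    (height_mul_height_add_inner_pos m y).le, norm_add_sq_real, norm_smul, mul_pow, Real.norm_eq_abs,
    sq_abs, real_inner_smul_right, real_inner_comm]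
  have hm := height_sq m
  have hy := height_sq y
  have h1 : 1 + height m ≠ 0 := by linarith [height_pos m]
  rw [← sub_eq_iff_eq_add'] at hm hy
  rw [← hm, ← hy]
  field_simp
  ring

theorem boost_neg_boost (m y : E) : boost (-m) (boost m y) = y := by
  rw [boost, height_boost, height_neg, boost, inner_add_right, inner_smul_right, inner_neg_left,
    inner_neg_left, real_inner_self_eq_norm_sq, add_assoc, smul_neg, ← sub_eq_add_neg, ← sub_smul]
  have hm := height_sq m
  rw [← sub_eq_iff_eq_add'] at hm
  have h1 : 1 + height m ≠ 0 := by linarith [height_pos m]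
  rw [← hm]
  convert add_zero y
  rw [← zero_smul ℝ m]
  congr 1
  field_simp
  ring

theorem boost_injective (m : E) : Function.Injective (boost m) :=
  Function.LeftInverse.injective (boost_neg_boost m)

theorem boost_surjective (m : E) : Function.Surjective (boost m) := fun y =>
  ⟨boost (-m) y, by simpa using boost_neg_boost (-m) y⟩

theorem hasFDerivAt_height (y : E) :
    HasFDerivAt (height : E → ℝ) ((height y)⁻¹ • innerSL ℝ y) y := by
  have h := ((hasStrictFDerivAt_norm_sq y).hasFDerivAt.const_add 1).sqrt
    (by positivity : 1 + ‖y‖ ^ 2 ≠ 0)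
  refine h.congr_fderiv ?_
  ext v
  simp [height]
  ring

/-- The derivative of the boost by `m`. -/
noncomputable def boostDeriv (m y : E) : E →L[ℝ] E :=
  ContinuousLinearMap.id ℝ E +
    ((1 + height m)⁻¹ • innerSL ℝ m + (height y)⁻¹ • innerSL ℝ y).smulRight m

theorem hasFDerivAt_boost (m y : E) : HasFDerivAt (boost m) (boostDeriv m y) y := by
  have h1 : HasFDerivAt (fun y : E => ⟪m, y⟫ / (1 + height m)) ((1 + height m)⁻¹ • innerSL ℝ m) y := by
    simp_rw [div_eq_inv_mul]
    exact ((innerSL ℝ m).hasFDerivAt (x := y)).const_mul _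
  exact (hasFDerivAt_id y).add ((h1.add (hasFDerivAt_height y)).smul_const m)

/-- The derivative is `id` plus a rank-one map `f ⊗ m`, so its determinant is `1 + f m`; it
simplifies through `‖m‖² = height m ^ 2 - 1`. -/
theorem det_boostDeriv [FiniteDimensional ℝ E] (m y : E) :
    (boostDeriv m y).det = height (boost m y) / height y := by
  have h : ((boostDeriv m y : E →L[ℝ] E) : E →ₗ[ℝ] E) = LinearMap.transvection
      ((1 + height m)⁻¹ • innerSL ℝ m + (height y)⁻¹ • innerSL ℝ y : E →L[ℝ] ℝ).toLinearMap m := rfl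
  rw [ContinuousLinearMap.det, h, LinearMap.transvection.det, height_boost]
  have hm := height_sq m
  rw [← sub_eq_iff_eq_add'] at hm
  have h1 : 1 + height m ≠ 0 := by linarith [height_pos m]
  have h2 := (height_pos y).ne'
  simp only [ContinuousLinearMap.coe_coe, _root_.add_apply,
    _root_.smul_apply, innerSL_apply_apply, real_inner_self_eq_norm_sq, smul_eq_mul,
    ← hm, real_inner_comm m y]
  field_simp
  ring

/-- Boosts preserve the measure `dy / √(1 + ‖y‖²)`. -/
theorem lintegral_boost [FiniteDimensional ℝ E] [MeasurableSpace E] [BorelSpace E] (m : E)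
    (F : E → ENNReal) :
    ∫⁻ y, ENNReal.ofReal (height y)⁻¹ * F (boost m y) =
      ∫⁻ y, ENNReal.ofReal (height y)⁻¹ * F y := by
  have := lintegral_image_eq_lintegral_abs_det_fderiv_mul (volume : Measure E) MeasurableSet.univ
    (fun y _ => (hasFDerivAt_boost m y).hasFDerivWithinAt) (boost_injective m).injOn
    (fun y => ENNReal.ofReal (height y)⁻¹ * F y)
  rw [Set.image_univ, (boost_surjective m).range_eq, Measure.restrict_univ] at this
  rw [this]
  refine lintegral_congr fun y => ?_
  have h1 := height_pos y
  have h2 := height_pos (boost m y)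
  rw [← mul_assoc, ← ENNReal.ofReal_mul (abs_nonneg _), det_boostDeriv, abs_of_pos (by positivity)]
  congr 2
  field_simp

/-- The radial map `z ↦ sinh ‖z‖ z / ‖z‖`. -/
noncomputable def radial (z : E) : E := (Real.sinh ‖z‖ / ‖z‖) • z

theorem norm_radial (z : E) : ‖radial z‖ = Real.sinh ‖z‖ := by
  have h := Real.sinh_nonneg_iff.2 (norm_nonneg z)
  rw [radial, norm_smul, Real.norm_eq_abs, abs_of_nonneg (by positivity)]
  rcases eq_or_ne ‖z‖ 0 with h0 | h0
  · simp [h0]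
  · exact div_mul_cancel₀ _ h0

theorem height_radial (z : E) : height (radial z) = Real.cosh ‖z‖ := by
  rw [height, norm_radial, add_comm, ← Real.cosh_sq, Real.sqrt_sq (Real.cosh_pos _).le]

theorem radial_injective : Function.Injective (radial : E → E) := by
  have key : ∀ z : E, (Real.arsinh ‖radial z‖ / ‖radial z‖) • radial z = z := by
    intro z
    rw [norm_radial, Real.arsinh_sinh, radial, smul_smul]
    rcases eq_or_ne z 0 with rfl | h0
    · simp
    · have h1 : ‖z‖ ≠ 0 := norm_ne_zero_iff.2 h0
      have h2 : Real.sinh ‖z‖ ≠ 0 := by simpa using h1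
      rw [show ‖z‖ / Real.sinh ‖z‖ * (Real.sinh ‖z‖ / ‖z‖) = 1 by field_simp, one_smul]
  intro a b hab
  rw [← key a, hab, key b]

theorem radial_image_compl_zero : (radial : E → E) '' {0}ᶜ = {0}ᶜ := by
  ext y
  simp only [Set.mem_image, Set.mem_compl_iff, Set.mem_singleton_iff]
  constructor
  · rintro ⟨z, hz, rfl⟩ h
    rw [← norm_eq_zero, norm_radial] at h
    exact hz (by simpa using h)
  · intro hy
    have hy1 : 0 < ‖y‖ := norm_pos_iff.2 hy
    have hy2 : 0 < Real.arsinh ‖y‖ := Real.arsinh_pos_iff.2 hy1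
    have hn : ‖(Real.arsinh ‖y‖ / ‖y‖) • y‖ = Real.arsinh ‖y‖ := by
      rw [norm_smul, Real.norm_eq_abs, abs_of_pos (by positivity), div_mul_cancel₀ _ hy1.ne']
    refine ⟨(Real.arsinh ‖y‖ / ‖y‖) • y, ?_, ?_⟩
    · rw [← norm_eq_zero, hn]
      exact hy2.ne'
    · rw [radial, hn, Real.sinh_arsinh, smul_smul,
        show ‖y‖ / Real.arsinh ‖y‖ * (Real.arsinh ‖y‖ / ‖y‖) = 1 by field_simp, one_smul]

theorem hasFDerivAt_radial {z : E} (hz : z ≠ 0) :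
    HasFDerivAt radial ((Real.sinh ‖z‖ / ‖z‖) • ContinuousLinearMap.id ℝ E +
      (((Real.cosh ‖z‖ * ‖z‖ - Real.sinh ‖z‖) / ‖z‖ ^ 3) • innerSL ℝ z).smulRight z) z := by
  have hz' : ‖z‖ ≠ 0 := norm_ne_zero_iff.2 hz
  have h1 : HasFDerivAt (fun z : E => ‖z‖) (‖z‖⁻¹ • innerSL ℝ z) z := by
    have h := ((hasStrictFDerivAt_norm_sq z).hasFDerivAt).sqrt (by positivity : ‖z‖ ^ 2 ≠ 0)
    simp_rw [Real.sqrt_sq (norm_nonneg _)] at h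
    refine h.congr_fderiv ?_
    ext v
    simp
    ring
  have h2 : HasDerivAt (fun r : ℝ => Real.sinh r / r)
      ((Real.cosh ‖z‖ * ‖z‖ - Real.sinh ‖z‖ * 1) / ‖z‖ ^ 2) ‖z‖ :=
    (Real.hasDerivAt_sinh _).div (hasDerivAt_id _) hz'
  refine ((h2.comp_hasFDerivAt z h1).smul (hasFDerivAt_id z)).congr_fderiv ?_
  ext v
  simp only [_root_.add_apply, _root_.smul_apply,
    ContinuousLinearMap.smulRight_apply, ContinuousLinearMap.id_apply, smul_smul, smul_eq_mul,
    mul_one, Function.comp_apply, id_eq]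
  congr 2
  field_simp

/-- A scalar times a transvection: the radial direction contributes `cosh ‖z‖`, each orthogonal
direction `sinh ‖z‖ / ‖z‖`. -/
theorem det_fderiv_radial [FiniteDimensional ℝ E] {z : E} (hz : z ≠ 0)
    (hd : 1 ≤ Module.finrank ℝ E) :
    ((Real.sinh ‖z‖ / ‖z‖) • ContinuousLinearMap.id ℝ E +
      (((Real.cosh ‖z‖ * ‖z‖ - Real.sinh ‖z‖) / ‖z‖ ^ 3) • innerSL ℝ z).smulRight z).det =
      (Real.sinh ‖z‖ / ‖z‖) ^ (Module.finrank ℝ E - 1) * Real.cosh ‖z‖ := by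
  have hz' : ‖z‖ ≠ 0 := norm_ne_zero_iff.2 hz
  have hs : Real.sinh ‖z‖ ≠ 0 := by simpa using hz'
  set c := Real.sinh ‖z‖ / ‖z‖ with hc
  have hc0 : c ≠ 0 := div_ne_zero hs hz'
  set b := (Real.cosh ‖z‖ * ‖z‖ - Real.sinh ‖z‖) / ‖z‖ ^ 3 with hb
  have h : ((c • ContinuousLinearMap.id ℝ E + (b • innerSL ℝ z).smulRight z : E →L[ℝ] E) :
      E →ₗ[ℝ] E) = c • LinearMap.transvection ((c⁻¹ * b) • innerSL ℝ z : E →L[ℝ] ℝ).toLinearMap z := by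
    ext v
    simp [LinearMap.transvection, smul_smul]
    congr 1
    field_simp
  rw [ContinuousLinearMap.det, h, LinearMap.det_smul, LinearMap.transvection.det,
    ← Nat.sub_add_cancel hd, pow_succ, Nat.add_sub_cancel, mul_assoc]
  congr 1
  simp only [ContinuousLinearMap.coe_coe, _root_.smul_apply, innerSL_apply_apply,
    real_inner_self_eq_norm_sq, smul_eq_mul, hb, hc]
  field_simp
  ring

/-- The factor `cosh ‖z‖` of the Jacobian is the height of the image point and cancels the weight.
The origin is removed as a null set. -/
theorem lintegral_radial [FiniteDimensional ℝ E] [MeasurableSpace E] [BorelSpace E]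
    (hd : 1 ≤ Module.finrank ℝ E) (F : E → ENNReal) :
    ∫⁻ z, ENNReal.ofReal ((Real.sinh ‖z‖ / ‖z‖) ^ (Module.finrank ℝ E - 1)) * F (radial z) =
      ∫⁻ y, ENNReal.ofReal (height y)⁻¹ * F y := by
  have : Nontrivial E := Module.nontrivial_of_finrank_pos (R := ℝ) hd
  have h := lintegral_image_eq_lintegral_abs_det_fderiv_mul (volume : Measure E)
    (measurableSet_singleton (0 : E)).compl
    (fun z hz => (hasFDerivAt_radial hz).hasFDerivWithinAt) radial_injective.injOn
    (fun y => ENNReal.ofReal (height y)⁻¹ * F y)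
  rw [radial_image_compl_zero, restrict_compl_singleton] at h
  rw [h]
  refine lintegral_congr_ae ?_
  filter_upwards [compl_mem_ae_iff.2 (measure_singleton (0 : E))] with z hz
  have h1 : 0 < Real.sinh ‖z‖ := Real.sinh_pos_iff.2 (norm_pos_iff.2 hz)
  have h2 := Real.cosh_pos ‖z‖
  have h3 : 0 < ‖z‖ := norm_pos_iff.2 hz
  rw [← mul_assoc, ← ENNReal.ofReal_mul (abs_nonneg _), det_fderiv_radial hz hd,
    abs_of_pos (by positivity), height_radial, mul_assoc, mul_inv_cancel₀ h2.ne', mul_one]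

end InnerProduct

/-! ### Spatial coordinates on the hyperboloid -/

variable {d : ℕ}

/-- The spatial coordinates of a point of the hyperboloid. -/
noncomputable def spatial (x : Hyp d) : EuclideanSpace ℝ (Fin d) :=
  WithLp.toLp 2 fun j => x.1 j.succ

theorem height_spatial (x : Hyp d) : height (spatial x) = x.1 0 := by
  rw [height, Real.sqrt_eq_iff_mul_self_eq (by positivity) x.2.2.le,
    EuclideanSpace.real_norm_sq_eq]
  have := x.2.1
  simp only [lor] at this
  simp only [spatial, sq]
  linarith

theorem spatial_injective : Function.Injective (spatial (d := d)) := by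
  intro x y h
  ext i
  refine Fin.cases ?_ (fun j => ?_) i
  · rw [← height_spatial, h, height_spatial]
  · simpa [spatial] using congrArg (fun v => v.ofLp j) h

/-- Parallel transport from `o` to `μ` is the restriction to `T_o` of the boost taking `o` to `μ`,
and isometries commute with exponential maps. Hence `μ` enters only through a boost. -/
theorem spatial_wrap (μ : Hyp d) (z : EuclideanSpace ℝ (Fin d)) :
    spatial (wrap μ z) = boost (spatial μ) (radial z) := by
  have h1 : lor μ.1 (originFrame d z).1 = ⟪spatial μ, z⟫ := by
    simp [lor, originFrame, spatial, PiLp.inner_apply, mul_comm]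
  have h2 : lor (origin d).1 μ.1 = - μ.1 0 := by simp [lor, origin]
  rw [boost, height_radial, height_spatial, radial, inner_smul_right]
  ext j
  change Real.cosh (tnorm (transport (origin d) μ (originFrame d z))) * μ.1 j.succ +
    (Real.sinh (tnorm (transport (origin d) μ (originFrame d z))) /
      tnorm (transport (origin d) μ (originFrame d z))) *
      (z.ofLp j + (lor μ.1 (originFrame d z).1 / (1 - lor (origin d).1 μ.1)) *
        ((origin d).1 j.succ + μ.1 j.succ)) = _
  rw [tnorm_transport_originFrame, h1, h2]
  simp only [origin, spatial,
    Fin.cons_succ, Pi.zero_apply, PiLp.add_apply, PiLp.smul_apply, smul_eq_mul]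
  ring

theorem wrap_surjective (μ : Hyp d) : Function.Surjective (wrap μ) := fun x =>
  ⟨tcoord μ x, wrap_tcoord μ x⟩

/-- The hyperbolic volume, in the tangent coordinates at any base point, has density
`(sinh ‖z‖ / ‖z‖)^(d-1)`; in particular the integral does not depend on the base point. -/
theorem lintegral_wrap_eq (hd : 1 ≤ d) (μ ν : Hyp d) (F : Hyp d → ENNReal) :
    ∫⁻ z : EuclideanSpace ℝ (Fin d),
        ENNReal.ofReal ((Real.sinh ‖z‖ / ‖z‖) ^ (d - 1)) * F (wrap μ z) =
      ∫⁻ z : EuclideanSpace ℝ (Fin d),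
        ENNReal.ofReal ((Real.sinh ‖z‖ / ‖z‖) ^ (d - 1)) * F (wrap ν z) := by
  have : Nonempty (Hyp d) := ⟨μ⟩
  -- The right-hand side is free of `μ`; `Function.invFun spatial` reads `F` in spatial coordinates.
  have key : ∀ μ : Hyp d, ∫⁻ z : EuclideanSpace ℝ (Fin d),
      ENNReal.ofReal ((Real.sinh ‖z‖ / ‖z‖) ^ (d - 1)) * F (wrap μ z) =
      ∫⁻ y : EuclideanSpace ℝ (Fin d),
        ENNReal.ofReal (height y)⁻¹ * F (Function.invFun spatial y) := by
    intro μ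
    have hF : ∀ z, F (wrap μ z) = (fun y => F (Function.invFun spatial y))
        (boost (spatial μ) (radial z)) := fun z => by
      simp only [← spatial_wrap, Function.leftInverse_invFun spatial_injective (wrap μ z)]
    have hfin : Module.finrank ℝ (EuclideanSpace ℝ (Fin d)) = d := by simp
    simp_rw [hF]
    rw [← lintegral_boost (spatial μ)]
    have := lintegral_radial (E := EuclideanSpace ℝ (Fin d)) (by rwa [hfin])
      (fun y => F (Function.invFun spatial (boost (spatial μ) y)))
    rwa [hfin] at this
  rw [key μ, key ν]

end Volume

/-! ### The log-density -/

section LogDensity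

variable {d : ℕ}

theorem phi_of_ne_zero {v : EuclideanSpace ℝ (Fin d)} (hv : v ≠ 0) :
    phi v = Real.log (Real.sinh ‖v‖ / ‖v‖) := by
  simp [phi, hv]

theorem phi_zero : phi (0 : EuclideanSpace ℝ (Fin d)) = 0 := by
  simp [phi]

theorem phi_nonneg (v : EuclideanSpace ℝ (Fin d)) : 0 ≤ phi v := by
  by_cases hv : v = 0
  · rw [hv, phi_zero]
  · rw [phi_of_ne_zero hv]
    refine Real.log_nonneg ?_
    rw [le_div_iff₀ (norm_pos_iff.2 hv), one_mul]
    exact Real.self_le_sinh_iff.2 (norm_nonneg v)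

/-- `sinh r ≤ r exp r` follows from `1 - 2r ≤ exp (-2r)`. The bound reduces integrability of the
volume term to a first moment. -/
theorem phi_le_norm (v : EuclideanSpace ℝ (Fin d)) : phi v ≤ ‖v‖ := by
  by_cases hv : v = 0
  · simp [hv, phi_zero]
  · have h0 : 0 < ‖v‖ := norm_pos_iff.2 hv
    have h1 : 0 < Real.sinh ‖v‖ := Real.sinh_pos_iff.2 h0
    rw [phi_of_ne_zero hv, Real.log_le_iff_le_exp (by positivity), div_le_iff₀ h0, Real.sinh_eq]
    have h2 : Real.exp (-‖v‖) = Real.exp ‖v‖ * Real.exp (-2 * ‖v‖) := by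
      rw [← Real.exp_add]
      ring_nf
    have h3 := Real.add_one_le_exp (-2 * ‖v‖)
    rw [h2]
    nlinarith [Real.exp_pos ‖v‖]

/-- `dslope Real.sinh 0` is `sinh r / r` with the value 1 filled in at 0, so `phi` is its logarithm
everywhere. -/
theorem continuous_phi : Continuous (phi : EuclideanSpace ℝ (Fin d) → ℝ) := by
  have h1 : Continuous (dslope Real.sinh 0) := by
    rw [← continuousOn_univ, continuousOn_dslope univ_mem]
    exact ⟨Real.continuous_sinh.continuousOn, Real.differentiable_sinh 0⟩
  have h2 : ∀ v : EuclideanSpace ℝ (Fin d), v ≠ 0 →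
      dslope Real.sinh 0 ‖v‖ = Real.sinh ‖v‖ / ‖v‖ := fun v hv => by
    rw [dslope_of_ne _ (norm_ne_zero_iff.2 hv), slope_def_field]
    simp
  have h3 : (phi : EuclideanSpace ℝ (Fin d) → ℝ) = fun v => Real.log (dslope Real.sinh 0 ‖v‖) := by
    ext v
    by_cases hv : v = 0
    · simp [hv, phi_zero]
    · rw [phi_of_ne_zero hv, h2 v hv]
  rw [h3]
  refine (h1.comp continuous_norm).log fun v => ?_
  by_cases hv : v = 0
  · simp [hv]
  · have h0 : 0 < ‖v‖ := norm_pos_iff.2 hv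
    have := Real.sinh_pos_iff.2 h0
    rw [Function.comp_apply, h2 v hv]
    positivity

theorem exp_mul_phi (hd : 1 ≤ d) {v : EuclideanSpace ℝ (Fin d)} (hv : v ≠ 0) :
    Real.exp (((d : ℝ) - 1) * phi v) = (Real.sinh ‖v‖ / ‖v‖) ^ (d - 1) := by
  have h0 : 0 < ‖v‖ := norm_pos_iff.2 hv
  have := Real.sinh_pos_iff.2 h0
  rw [phi_of_ne_zero hv, ← Nat.cast_pred hd, Real.exp_nat_mul, Real.exp_log (by positivity)]

theorem continuous_inv_val : Continuous fun S : SPD d => S.1⁻¹ := by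
  have h0 : Continuous fun S : SPD d => S.1.det := Continuous.matrix_det continuous_subtype_val
  have hne : ∀ S : SPD d, S.1.det ≠ 0 := fun S => S.2.det_pos.ne'
  have h1 : Continuous fun S : SPD d => (S.1.det)⁻¹ := h0.inv₀ hne
  have h2 : Continuous fun S : SPD d => S.1.adjugate :=
    Continuous.matrix_adjugate continuous_subtype_val
  have h3 : ∀ S : SPD d, S.1⁻¹ = (S.1.det)⁻¹ • S.1.adjugate := fun S => by
    rw [Matrix.inv_def, Ring.inverse_eq_inv']
  simp_rw [h3]
  exact h1.smul h2

theorem continuous_logDensity :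
    Continuous fun p : (Hyp d × SPD d) × Hyp d => logDensity p.1 p.2 := by
  have hp : Continuous fun p : (Hyp d × SPD d) × Hyp d => ((p.1.1, p.2) : Hyp d × Hyp d) :=
    (continuous_fst.comp continuous_fst).prodMk continuous_snd
  have ht : Continuous fun p : (Hyp d × SPD d) × Hyp d => tcoord p.1.1 p.2 := by
    have := continuous_tcoord.comp hp
    exact this
  have ht' : Continuous fun p : (Hyp d × SPD d) × Hyp d => (tcoord p.1.1 p.2).ofLp :=
    (PiLp.continuous_ofLp 2 (fun _ : Fin d => ℝ)).comp ht
  have hS : Continuous fun p : (Hyp d × SPD d) × Hyp d => p.1.2 :=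
    continuous_snd.comp continuous_fst
  have hdet : Continuous fun p : (Hyp d × SPD d) × Hyp d => p.1.2.1.det :=
    Continuous.matrix_det (continuous_subtype_val.comp hS)
  have hne : ∀ p : (Hyp d × SPD d) × Hyp d, p.1.2.1.det ≠ 0 := fun p => p.1.2.2.det_pos.ne'
  have hinv : Continuous fun p : (Hyp d × SPD d) × Hyp d => p.1.2.1⁻¹ :=
    continuous_inv_val.comp hS
  unfold logDensity
  exact ((continuous_const.mul (hdet.log hne)).sub (continuous_const.mul
    (ht'.dotProduct (hinv.matrix_mulVec ht')))).sub (continuous_const.mul (continuous_phi.comp ht))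

theorem logDensity_wrap (μ : Hyp d) (S : SPD d) (z : EuclideanSpace ℝ (Fin d)) :
    logDensity (μ, S) (wrap μ z) = -(1 / 2) * Real.log S.1.det
      - (1 / 2) * (z.ofLp ⬝ᵥ (S.1⁻¹ *ᵥ z.ofLp)) - ((d : ℝ) - 1) * phi z := by
  simp only [logDensity, tcoord_wrap]

/-! ### Likelihood ratios, identifiability and integrability -/

instance isProbabilityMeasure_hwn (μ : Hyp d) (S : SPD d) : IsProbabilityMeasure (hwn μ S) :=
  Measure.isProbabilityMeasure_map (measurable_wrap μ).aemeasurable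

/-- The law `HWN_d(μ, S)` has density `(2π)^{-d/2} exp m_{μ,S}` with respect to the hyperbolic
volume. -/
theorem lintegral_hwn (hd : 1 ≤ d) (μ : Hyp d) (S : SPD d) {F : Hyp d → ENNReal}
    (hF : Measurable F) :
    ∫⁻ x, F x ∂(hwn μ S) = ∫⁻ z : EuclideanSpace ℝ (Fin d),
      ENNReal.ofReal ((Real.sinh ‖z‖ / ‖z‖) ^ (d - 1)) *
        (ENNReal.ofReal (Real.exp (-(d / 2 * Real.log (2 * Real.pi))
          + logDensity (μ, S) (wrap μ z))) * F (wrap μ z)) := by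
  have : NeZero d := ⟨by lia⟩
  rw [hwn, lintegral_map hF (measurable_wrap μ), lintegral_multivariateGaussian S.2
    (fun z => F (wrap μ z)) (hF.comp (measurable_wrap μ))]
  refine lintegral_congr_ae ?_
  -- At the origin the quotient takes the default value `0 / 0 = 0` while `exp (phi 0) = 1`, so that
  -- point is discarded.
  filter_upwards [compl_mem_ae_iff.2 (measure_singleton (0 : EuclideanSpace ℝ (Fin d)))] with z hz
  rw [← mul_assoc, ← ENNReal.ofReal_mul (by positivity), ← exp_mul_phi hd hz, ← Real.exp_add,
    logDensity_wrap]
  congr 3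
  ring

/-- Likelihood ratios have expectation one. -/
theorem lintegral_likelihood_ratio (hd : 1 ≤ d) (θ θ₀ : Hyp d × SPD d) :
    ∫⁻ x, ENNReal.ofReal (Real.exp (logDensity θ x - logDensity θ₀ x)) ∂(hwn θ₀.1 θ₀.2) = 1 := by
  have hm : ∀ θ : Hyp d × SPD d, Measurable (logDensity θ) := fun θ =>
    (continuous_logDensity.comp (Continuous.prodMk_right θ)).measurable
  have h1 := lintegral_hwn hd θ.1 θ.2 (F := fun _ => 1) measurable_const
  rw [lintegral_one, measure_univ] at h1
  rw [lintegral_hwn hd θ₀.1 θ₀.2 (by have := hm θ; have := hm θ₀; fun_prop), h1]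
  simp only [mul_one]
  -- Invariance of the hyperbolic volume enters here: the total mass for `θ` is rewritten in tangent
  -- coordinates at the base point of `θ₀`.
  rw [lintegral_wrap_eq hd θ.1 θ₀.1 fun x => ENNReal.ofReal
    (Real.exp (-(d / 2 * Real.log (2 * Real.pi)) + logDensity θ x))]
  refine lintegral_congr fun z => ?_
  rw [← ENNReal.ofReal_mul (Real.exp_nonneg _), ← Real.exp_add]
  congr 3
  ring

theorem logDensity_self (μ : Hyp d) (S : SPD d) :
    logDensity (μ, S) μ = -(1 / 2) * Real.log S.1.det := by
  simp [logDensity, tcoord_self, phi_zero]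

/-- Away from `μ` the quadratic form is strictly positive and the volume term only lowers the value.
So `μ` is the unique mode, which identifies it. -/
theorem logDensity_lt (hd : 1 ≤ d) {μ x : Hyp d} (S : SPD d) (h : μ ≠ x) :
    logDensity (μ, S) x < logDensity (μ, S) μ := by
  have hv : tcoord μ x ≠ 0 := fun h0 => h (eq_of_rho_eq_zero (by rw [← norm_tcoord, h0, norm_zero]))
  have h1 : 0 < (tcoord μ x).ofLp ⬝ᵥ (S.1⁻¹ *ᵥ (tcoord μ x).ofLp) := by
    have := S.2.inv.dotProduct_mulVec_pos (x := (tcoord μ x).ofLp) (by simpa using hv)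
    simpa using this
  have h2 := phi_nonneg (tcoord μ x)
  have h3 : (0 : ℝ) ≤ (d : ℝ) - 1 := by
    have : (1 : ℝ) ≤ d := by exact_mod_cast hd
    linarith
  rw [logDensity_self]
  simp only [logDensity]
  nlinarith [mul_nonneg h3 h2]

/-- The parameters of the hyperbolic wrapped normal distribution are determined by its
log-density. -/
theorem eq_of_logDensity_eq (hd : 1 ≤ d) {θ θ₀ : Hyp d × SPD d}
    (h : logDensity θ = logDensity θ₀) : θ = θ₀ := by
  obtain ⟨μ, S⟩ := θ
  obtain ⟨μ₀, S₀⟩ := θ₀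
  have hμ : μ = μ₀ := by
    by_contra hne
    have h1 := logDensity_lt hd S hne
    have h2 := logDensity_lt hd S₀ (Ne.symm hne)
    rw [h] at h1
    exact lt_asymm h1 h2
  subst hμ
  have hdet := congrFun h μ
  rw [logDensity_self, logDensity_self] at hdet
  have hq : ∀ v : Fin d → ℝ, v ⬝ᵥ (S.1⁻¹ *ᵥ v) = v ⬝ᵥ (S₀.1⁻¹ *ᵥ v) := fun v => by
    have := congrFun h (wrap μ (WithLp.toLp 2 v))
    rw [logDensity_wrap, logDensity_wrap, hdet] at this
    simpa using this
  have hsymm : ∀ T : SPD d, ∀ i j, T.1⁻¹ i j = T.1⁻¹ j i := fun T i j => by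
    simpa using (T.2.inv.isHermitian.apply j i)
  -- Polarization: values at `eᵢ + eⱼ`, together with the diagonal, recover the off-diagonal
  -- entries.
  have hexp : ∀ T : SPD d, ∀ i j, (Pi.single i 1 + Pi.single j 1 : Fin d → ℝ) ⬝ᵥ
      (T.1⁻¹ *ᵥ (Pi.single i 1 + Pi.single j 1)) =
      T.1⁻¹ i i + T.1⁻¹ j j + 2 * T.1⁻¹ i j := fun T i j => by
    simp only [mulVec_add, dotProduct_add, add_dotProduct, mulVec_single_one,
      single_one_dotProduct, col_apply, hsymm T j i]
    ring
  have hdiag : ∀ i, S.1⁻¹ i i = S₀.1⁻¹ i i := fun i => by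
    simpa using hq (Pi.single i 1)
  have hinv : S.1⁻¹ = S₀.1⁻¹ := by
    ext i j
    have := hq (Pi.single i 1 + Pi.single j 1)
    rw [hexp, hexp, hdiag i, hdiag j] at this
    linarith
  have hS : S = S₀ := Subtype.ext (by
    rw [← Matrix.nonsing_inv_nonsing_inv S.1 (isUnit_iff_ne_zero.2 S.2.det_pos.ne'), hinv,
      Matrix.nonsing_inv_nonsing_inv S₀.1 (isUnit_iff_ne_zero.2 S₀.2.det_pos.ne')])
  rw [hS]

/-- The Gaussian density vanishes nowhere. Full support upgrades almost sure equality of continuous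
functions to equality. -/
theorem isOpenPosMeasure_multivariateGaussian {S : Matrix (Fin d) (Fin d) ℝ} (hS : S.PosDef) :
    (multivariateGaussian 0 S).IsOpenPosMeasure where
  open_pos U hU hne h0 := by
    rw [← lintegral_indicator_one hU.measurableSet, lintegral_multivariateGaussian hS _
      (measurable_one.indicator hU.measurableSet), lintegral_eq_zero_iff'] at h0
    · have : volume U = 0 := by
        rw [measure_eq_zero_iff_ae_notMem]
        filter_upwards [h0] with z hz hzU
        simp [hzU] at hz
        exact absurd hz (not_le.2 (Real.exp_pos _))
      exact hne.ne_empty (hU.measure_eq_zero_iff volume |>.1 this)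
    · have hq : Continuous fun w : EuclideanSpace ℝ (Fin d) => w.ofLp ⬝ᵥ (S⁻¹ *ᵥ w.ofLp) := by
        fun_prop
      have := hq.measurable
      exact (Measurable.mul (by fun_prop) (measurable_one.indicator hU.measurableSet)).aemeasurable

theorem continuous_logDensity_right (θ : Hyp d × SPD d) : Continuous (logDensity θ) :=
  continuous_logDensity.comp (Continuous.prodMk_right θ)

/-- Replacing `sinh ‖z‖ / ‖z‖` by `exp (phi z)` removes the singularity; at `z = 0` the linear
factor vanishes, so nothing changes. -/
theorem continuous_wrap (μ : Hyp d) : Continuous (wrap μ) := by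
  let L : EuclideanSpace ℝ (Fin d) →ₗ[ℝ] (Fin (d + 1) → ℝ) :=
    (tangent μ).subtype ∘ₗ (transport (origin d) μ).toLinearMap ∘ₗ (originFrame d).toLinearMap
  have hL : Continuous L := L.continuous_of_finiteDimensional
  have h : ∀ z, (wrap μ z).1 = Real.cosh ‖z‖ • μ.1 + Real.exp (phi z) • L z := by
    intro z
    change Real.cosh (tnorm (transport (origin d) μ (originFrame d z))) • μ.1 +
      (Real.sinh (tnorm (transport (origin d) μ (originFrame d z))) /
        tnorm (transport (origin d) μ (originFrame d z))) • L z = _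
    rw [tnorm_transport_originFrame]
    by_cases hz : z = 0
    · simp [hz]
    · have h0 : 0 < ‖z‖ := norm_pos_iff.2 hz
      have := Real.sinh_pos_iff.2 h0
      rw [phi_of_ne_zero hz, Real.exp_log (by positivity)]
  rw [continuous_induced_rng]
  change Continuous fun z => (wrap μ z).1
  simp_rw [h]
  exact ((Real.continuous_cosh.comp continuous_norm).smul continuous_const).add
    ((Real.continuous_exp.comp continuous_phi).smul hL)

/-- Log-densities that agree almost surely have the same parameters. -/
theorem eq_of_logDensity_ae_eq (hd : 1 ≤ d) {θ θ₀ : Hyp d × SPD d}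
    (h : logDensity θ =ᵐ[hwn θ₀.1 θ₀.2] logDensity θ₀) : θ = θ₀ := by
  have := isOpenPosMeasure_multivariateGaussian θ₀.2.2
  have h1 : logDensity θ ∘ wrap θ₀.1 =ᵐ[multivariateGaussian 0 θ₀.2.1] logDensity θ₀ ∘ wrap θ₀.1 :=
    ae_of_ae_map (measurable_wrap θ₀.1).aemeasurable h
  have h2 := (((continuous_logDensity_right θ).comp (continuous_wrap θ₀.1)).ae_eq_iff_eq _
    ((continuous_logDensity_right θ₀).comp (continuous_wrap θ₀.1))).1 h1
  exact eq_of_logDensity_eq hd ((wrap_surjective θ₀.1).injective_comp_right h2)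

/-- Under its own law the tangent coordinate is Gaussian, and the log-density grows at most
quadratically in it. -/
theorem integrable_logDensity (θ : Hyp d × SPD d) :
    Integrable (logDensity θ) (hwn θ.1 θ.2) := by
  obtain ⟨μ, S⟩ := θ
  rw [hwn, integrable_map_measure (continuous_logDensity_right _).aestronglyMeasurable
    (measurable_wrap μ).aemeasurable]
  have hm1 : Integrable (fun z : EuclideanSpace ℝ (Fin d) => ‖z‖) (multivariateGaussian 0 S.1) :=
    (IsGaussian.integrable_id (μ := multivariateGaussian 0 S.1)).norm
  have hm2 : Integrable (fun z : EuclideanSpace ℝ (Fin d) => ‖z‖ ^ 2)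
      (multivariateGaussian 0 S.1) :=
    (IsGaussian.memLp_two_id (μ := multivariateGaussian 0 S.1)).norm.integrable_sq
  have hq : ∀ z : EuclideanSpace ℝ (Fin d), |z.ofLp ⬝ᵥ (S.1⁻¹ *ᵥ z.ofLp)| ≤
      ‖toEuclideanCLM (𝕜 := ℝ) S.1⁻¹‖ * ‖z‖ ^ 2 := by
    intro z
    have h1 : z.ofLp ⬝ᵥ (S.1⁻¹ *ᵥ z.ofLp) = inner ℝ z (toEuclideanCLM (𝕜 := ℝ) S.1⁻¹ z) := by
      simp [inner_toEuclideanCLM]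
    rw [h1]
    calc _ ≤ ‖z‖ * ‖toEuclideanCLM (𝕜 := ℝ) S.1⁻¹ z‖ := abs_real_inner_le_norm _ _
      _ ≤ ‖z‖ * (‖toEuclideanCLM (𝕜 := ℝ) S.1⁻¹‖ * ‖z‖) := by
        gcongr
        exact ContinuousLinearMap.le_opNorm _ _
      _ = _ := by ring
  refine Integrable.mono' (((integrable_const |(1 / 2) * Real.log S.1.det|).add
    ((hm2.const_mul ‖toEuclideanCLM (𝕜 := ℝ) S.1⁻¹‖).const_mul (1 / 2))).add
    (hm1.const_mul |(d : ℝ) - 1|))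
    ((continuous_logDensity_right _).comp (continuous_wrap μ)).aestronglyMeasurable
    (ae_of_all _ fun z => ?_)
  rw [Function.comp_apply, logDensity_wrap, Real.norm_eq_abs]
  simp only [Pi.add_apply]
  have h1 : |((d : ℝ) - 1) * phi z| ≤ |(d : ℝ) - 1| * ‖z‖ := by
    rw [abs_mul, abs_of_nonneg (phi_nonneg z)]
    exact mul_le_mul_of_nonneg_left (phi_le_norm z) (abs_nonneg _)
  have h2 := hq z
  rw [abs_le] at h1 h2 ⊢
  have h3 := abs_le.1 (le_refl |(1 / 2) * Real.log S.1.det|)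
  constructor <;> linarith [h1.1, h1.2, h2.1, h2.2, h3.1, h3.2]

end LogDensity

/-! ### Gibbs' inequality -/

/-- **Gibbs' inequality** for log-likelihoods bounded above by a constant. -/
theorem ae_eq_of_lintegral_sub_le {𝒳 : Type*} [MeasurableSpace 𝒳] {Q : Measure 𝒳}
    [IsProbabilityMeasure Q] {m m₀ : 𝒳 → ℝ} {C : ℝ} (hm : Measurable m) (hC : ∀ x, m x ≤ C)
    (hi₀ : Integrable m₀ Q) (hC₀ : ∀ x, m₀ x ≤ C)
    (hexp : ∫⁻ x, ENNReal.ofReal (Real.exp (m x - m₀ x)) ∂Q ≤ 1)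
    (hle : ∫⁻ x, ENNReal.ofReal (C - m x) ∂Q ≤ ∫⁻ x, ENNReal.ofReal (C - m₀ x) ∂Q) :
    m =ᵐ[Q] m₀ := by
  have hg₀ : Integrable (fun x => C - m₀ x) Q := (integrable_const C).sub hi₀
  have hnn : ∀ x, 0 ≤ C - m x := fun x => sub_nonneg.2 (hC x)
  have hnn₀ : ∀ x, 0 ≤ C - m₀ x := fun x => sub_nonneg.2 (hC₀ x)
  rw [← ofReal_integral_eq_lintegral_ofReal hg₀ (ae_of_all _ hnn₀)] at hle
  -- Integrability of `m` is not assumed; the inequality `hle` forces it.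
  have hg : Integrable (fun x => C - m x) Q :=
    (lintegral_ofReal_ne_top_iff_integrable (by fun_prop) (ae_of_all _ hnn)).1
      (hle.trans_lt ENNReal.ofReal_lt_top).ne
  rw [← ofReal_integral_eq_lintegral_ofReal hg (ae_of_all _ hnn),
    ENNReal.ofReal_le_ofReal_iff (integral_nonneg hnn₀)] at hle
  have hD : Integrable (fun x => m x - m₀ x) Q := by
    refine (hg₀.sub hg).congr (ae_of_all _ fun x => ?_)
    simp
  have hDpos : 0 ≤ ∫ x, (m x - m₀ x) ∂Q := by
    have : ∫ x, (m x - m₀ x) ∂Q = ∫ x, (C - m₀ x) ∂Q - ∫ x, (C - m x) ∂Q := by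
      rw [← integral_sub hg₀ hg]
      congr 1
      ext x
      ring
    linarith
  have hem : AEStronglyMeasurable (fun x => Real.exp (m x - m₀ x)) Q :=
    Real.continuous_exp.comp_aestronglyMeasurable hD.aestronglyMeasurable
  have hE : Integrable (fun x => Real.exp (m x - m₀ x)) Q :=
    (lintegral_ofReal_ne_top_iff_integrable hem (ae_of_all _ fun x => Real.exp_nonneg _)).1
      (hexp.trans_lt ENNReal.one_lt_top).ne
  rw [← ofReal_integral_eq_lintegral_ofReal hE (ae_of_all _ fun x => Real.exp_nonneg _),
    ENNReal.ofReal_le_one] at hexp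
  -- The remainder `exp t - (t + 1)` is nonnegative and has integral at most `1 - (0 + 1)`. So it
  -- vanishes almost surely, which happens only at `t = 0`.
  have hrem : ∀ x, 0 ≤ Real.exp (m x - m₀ x) - ((m x - m₀ x) + 1) := fun x =>
    sub_nonneg.2 (Real.add_one_le_exp _)
  have hD1 : Integrable (fun x => (m x - m₀ x) + 1) Q := hD.add (integrable_const 1)
  have hri : Integrable (fun x => Real.exp (m x - m₀ x) - ((m x - m₀ x) + 1)) Q :=
    hE.sub hD1
  have hzero : ∫ x, (Real.exp (m x - m₀ x) - ((m x - m₀ x) + 1)) ∂Q = 0 := by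
    refine le_antisymm ?_ (integral_nonneg hrem)
    rw [integral_sub hE hD1, integral_add hD (integrable_const 1)]
    simp
    linarith
  filter_upwards [(integral_eq_zero_iff_of_nonneg hrem hri).1 hzero] with x hx
  by_contra hne
  have := Real.add_one_lt_exp (sub_ne_zero.2 hne)
  simp only [Pi.zero_apply] at hx
  linarith

/-! ### The eigenvalue shell -/

section Shell

variable {d : ℕ} {lo hi : ℝ}

theorem dotProduct_mulVec_le_of_mem_shell {S : SPD d} (hS : S ∈ shell d lo hi) (v : Fin d → ℝ) :
    v ⬝ᵥ (S.1 *ᵥ v) ≤ hi * (v ⬝ᵥ v) := by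
  have := hS.2.dotProduct_mulVec_nonneg v
  simp only [star_trivial, sub_mulVec, smul_mulVec, one_mulVec, dotProduct_sub, dotProduct_smul,
    smul_eq_mul] at this
  linarith

/-- Evaluate the form of `S` at `w - v / hi` with `w = S⁻¹ v`, then bound the term `v ⬝ᵥ S v / hi²`
by `(v ⬝ᵥ v) / hi`. -/
theorem le_dotProduct_inv_mulVec {S : SPD d} (hhi : 0 < hi) (hS : S ∈ shell d lo hi)
    (v : Fin d → ℝ) : (v ⬝ᵥ v) / hi ≤ v ⬝ᵥ (S.1⁻¹ *ᵥ v) := by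
  set w := S.1⁻¹ *ᵥ v with hw
  have hSw : S.1 *ᵥ w = v := by
    rw [hw, mulVec_mulVec, Matrix.mul_nonsing_inv _ (isUnit_iff_ne_zero.2 S.2.det_pos.ne'),
      one_mulVec]
  have hsymm : w ⬝ᵥ (S.1 *ᵥ v) = v ⬝ᵥ v := by
    have hT : S.1ᵀ = S.1 := by
      simpa [IsHermitian, conjTranspose_eq_transpose_of_trivial] using S.2.isHermitian
    rw [dotProduct_mulVec, ← mulVec_transpose, hT, hSw]
  have h := S.2.posSemidef.dotProduct_mulVec_nonneg (w - hi⁻¹ • v)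
  simp only [star_trivial, mulVec_sub, mulVec_smul, sub_dotProduct, dotProduct_sub, hSw,
    smul_dotProduct, dotProduct_smul, smul_eq_mul, hsymm] at h
  have h2 := mul_le_mul_of_nonneg_left (dotProduct_mulVec_le_of_mem_shell hS v)
    (by positivity : 0 ≤ hi⁻¹ * hi⁻¹)
  rw [show hi⁻¹ * hi⁻¹ * (hi * (v ⬝ᵥ v)) = hi⁻¹ * (v ⬝ᵥ v) by field_simp] at h2
  rw [div_eq_inv_mul, dotProduct_comm v w]
  rw [mul_sub, ← mul_assoc] at h
  linarith

theorem isClosed_setOf_posSemidef :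
    IsClosed {S : Matrix (Fin d) (Fin d) ℝ | S.PosSemidef} := by
  simp_rw [posSemidef_iff_dotProduct_mulVec, Set.ofPred_and, Set.ofPred_forall]
  refine IsClosed.inter ?_ (isClosed_iInter fun x => ?_)
  · exact isClosed_eq (Continuous.matrix_conjTranspose continuous_id) continuous_id
  · exact isClosed_le continuous_const
      (continuous_const.dotProduct (Continuous.matrix_mulVec continuous_id continuous_const))

/-- The bound by `lo` keeps limits positive definite, so the shell is closed among all matrices.
Testing on `eᵢ ± eⱼ` bounds the entries by `hi`. -/
theorem isCompact_shell (hlo : 0 < lo) : IsCompact (shell d lo hi) := by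
  rw [Subtype.isCompact_iff]
  have himage : Subtype.val '' shell d lo hi = {S : Matrix (Fin d) (Fin d) ℝ |
      (S - lo • (1 : Matrix (Fin d) (Fin d) ℝ)).PosSemidef ∧
      (hi • (1 : Matrix (Fin d) (Fin d) ℝ) - S).PosSemidef} := by
    ext S
    constructor
    · rintro ⟨T, hT, rfl⟩
      exact hT
    · intro hS
      have hpd : S.PosDef := by
        have := PosDef.posSemidef_add hS.1 ((PosDef.one (n := Fin d) (R := ℝ)).smul hlo)
        simpa using this
      exact ⟨⟨S, hpd⟩, hS, rfl⟩
  rw [himage]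
  refine IsCompact.of_isClosed_subset (isCompact_univ_pi fun _ : Fin d =>
    isCompact_univ_pi fun _ : Fin d => isCompact_Icc (a := -hi) (b := hi)) ?_ ?_
  · exact (isClosed_setOf_posSemidef.preimage (continuous_id.sub continuous_const)).inter
      (isClosed_setOf_posSemidef.preimage (continuous_const.sub continuous_id))
  · rw [← himage]
    rintro _ ⟨S, hS, rfl⟩ i _ j _
    have hsymm : S.1 j i = S.1 i j := by simpa using S.2.isHermitian.apply i j
    have hdiag : ∀ i, S.1 i i ≤ hi := fun i => by
      simpa using dotProduct_mulVec_le_of_mem_shell hS (Pi.single i 1)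
    have h1 := S.2.posSemidef.dotProduct_mulVec_nonneg (Pi.single i 1 + Pi.single j 1)
    have h2 := S.2.posSemidef.dotProduct_mulVec_nonneg (Pi.single i 1 - Pi.single j 1)
    simp only [star_trivial, mulVec_add, mulVec_sub, dotProduct_add, add_dotProduct, dotProduct_sub,
      sub_dotProduct, mulVec_single_one, single_one_dotProduct, col_apply, hsymm] at h1 h2
    constructor <;> linarith [hdiag i, hdiag j]

/-- The log-determinant is bounded on the compact shell and the volume term has a favourable sign,
so the quadratic decay is uniform in `Σ`. -/
theorem exists_logDensity_le (hlo : 0 < lo) (hlohi : lo < hi) (hd : 1 ≤ d) :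
    ∃ C : ℝ, ∀ μ : Hyp d, ∀ S ∈ shell d lo hi, ∀ x,
      logDensity (μ, S) x ≤ C - rho μ x ^ 2 / (2 * hi) := by
  have hc : Continuous fun S : SPD d => -(1 / 2) * Real.log S.1.det := by
    have h0 : Continuous fun S : SPD d => S.1.det := Continuous.matrix_det continuous_subtype_val
    have hne : ∀ S : SPD d, S.1.det ≠ 0 := fun S => S.2.det_pos.ne'
    exact continuous_const.mul (h0.log hne)
  obtain ⟨C, hC⟩ := ((isCompact_shell (d := d) (hi := hi) hlo).image hc).bddAbove
  refine ⟨C, fun μ S hS x => ?_⟩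
  have h1 : -(1 / 2) * Real.log S.1.det ≤ C := hC ⟨S, hS, rfl⟩
  have h2 := le_dotProduct_inv_mulVec (hlo.trans hlohi) hS (tcoord μ x).ofLp
  have h3 : (tcoord μ x).ofLp ⬝ᵥ (tcoord μ x).ofLp = rho μ x ^ 2 := by
    rw [← norm_tcoord, EuclideanSpace.real_norm_sq_eq]
    simp [dotProduct, sq]
  have h4 : (0 : ℝ) ≤ ((d : ℝ) - 1) * phi (tcoord μ x) := by
    refine mul_nonneg ?_ (phi_nonneg _)
    have : (1 : ℝ) ≤ d := by exact_mod_cast hd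
    linarith
  rw [h3] at h2
  have h5 : rho μ x ^ 2 / (2 * hi) = (1 / 2) * (rho μ x ^ 2 / hi) := by
    field_simp
  rw [h5]
  simp only [logDensity]
  linarith

theorem spectrum_subset_Icc_of_mem_shell {S : SPD d} (hS : S ∈ shell d lo hi) :
    spectrum ℝ S.1 ⊆ Set.Icc lo hi := by
  intro x hx
  have h1 := (posSemidef_iff_isHermitian_and_spectrum_nonneg.1 hS.1).2
  have h2 := (posSemidef_iff_isHermitian_and_spectrum_nonneg.1 hS.2).2
  constructor
  · have : x - lo ∈ spectrum ℝ (S.1 - lo • (1 : Matrix (Fin d) (Fin d) ℝ)) := by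
      rw [← Algebra.algebraMap_eq_smul_one, ← spectrum.sub_singleton_eq]
      exact Set.sub_mem_sub hx rfl
    simpa using h1 this
  · have : hi - x ∈ spectrum ℝ (hi • (1 : Matrix (Fin d) (Fin d) ℝ) - S.1) := by
      rw [← Algebra.algebraMap_eq_smul_one, ← spectrum.singleton_sub_eq]
      exact Set.sub_mem_sub rfl hx
    simpa using h2 this

-- The functional calculus is continuous along matrices with spectrum in a fixed compact set; the
-- shell provides `[lo, hi]`, where `log` is continuous.
open scoped Matrix.Norms.L2Operator in
theorem tendsto_cfc_log {ι : Type*} {l : Filter ι} (hlo : 0 < lo) {S : ι → SPD d} {S₀ : SPD d}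
    (hS : ∀ᶠ n in l, S n ∈ shell d lo hi) (hS₀ : S₀ ∈ shell d lo hi) (h : Tendsto S l (𝓝 S₀)) :
    Tendsto (fun n => cfc Real.log (S n).1) l (𝓝 (cfc Real.log S₀.1)) :=
  Filter.Tendsto.cfc (isCompact_Icc (a := lo) (b := hi)) Real.log
    ((continuous_subtype_val.tendsto S₀).comp h)
    (hS.mono fun _ hn => spectrum_subset_Icc_of_mem_shell hn)
    (Eventually.of_forall fun n => (S n).2.isHermitian)
    (spectrum_subset_Icc_of_mem_shell hS₀) S₀.2.isHermitian
    (Real.continuousOn_log.mono fun _ hx => (hlo.trans_le hx.1).ne')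

end Shell

/-! ### Points far from the origin -/

section Infinity

variable {d : ℕ}

theorem isCompact_setOf_time_le (R : ℝ) : IsCompact {μ : Hyp d | μ.1 0 ≤ R} := by
  rw [Subtype.isCompact_iff]
  have himage : Subtype.val '' {μ : Hyp d | μ.1 0 ≤ R} =
      {x : Fin (d + 1) → ℝ | lor x x = -1 ∧ 0 ≤ x 0 ∧ x 0 ≤ R} := by
    ext x
    constructor
    · rintro ⟨μ, hμ, rfl⟩
      exact ⟨μ.2.1, μ.2.2.le, hμ⟩
    · rintro ⟨h1, h2, h3⟩
      -- The open condition `0 < x 0` can be relaxed to a closed one, since `x 0 = 0` would make the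
      -- form nonnegative.
      refine ⟨⟨x, h1, h2.lt_of_ne fun h0 => ?_⟩, h3, rfl⟩
      have : 0 ≤ ∑ j : Fin d, x j.succ * x j.succ :=
        Finset.sum_nonneg fun j _ => mul_self_nonneg _
      simp only [lor, ← h0] at h1
      linarith
  rw [himage]
  refine IsCompact.of_isClosed_subset
    (isCompact_univ_pi fun _ : Fin (d + 1) => isCompact_Icc (a := -R) (b := R)) ?_ ?_
  · have : Continuous fun x : Fin (d + 1) → ℝ => lor x x := by
      unfold lor
      fun_prop
    exact (isClosed_eq this continuous_const).inter
      ((isClosed_le continuous_const (continuous_apply 0)).inter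
        (isClosed_le (continuous_apply 0) continuous_const))
  · rintro x ⟨h1, h2, h3⟩ i _
    refine Fin.cases ⟨by linarith, h3⟩ (fun j => ?_) i
    have hj : x j.succ * x j.succ ≤ ∑ j : Fin d, x j.succ * x j.succ :=
      Finset.single_le_sum (f := fun j : Fin d => x j.succ * x j.succ)
        (fun j _ => mul_self_nonneg _) (Finset.mem_univ j)
    simp only [lor] at h1
    exact abs_le_of_sq_le_sq' (by nlinarith) (by linarith)

/-- Cauchy-Schwarz gives `-⟨μ, x⟩ ≥ μ₀ (x₀ - ‖x‖)`, with `‖x‖` the spatial norm, and `x₀ - ‖x‖ = 1 /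
(x₀ + ‖x‖) ≥ 1 / (2 x₀)`. Thus `ρ(μ, x)` grows with `μ₀` uniformly for bounded `x`. -/
theorem time_div_le_neg_lor (μ x : Hyp d) : μ.1 0 / (2 * x.1 0) ≤ -lor μ.1 x.1 := by
  have h := abs_le.1 (abs_real_inner_le_norm (spatial μ) (spatial x))
  have h1 : inner ℝ (spatial μ) (spatial x) = ∑ j : Fin d, μ.1 j.succ * x.1 j.succ := by
    simp [spatial, PiLp.inner_apply, mul_comm]
  have hμ := height_sq (spatial μ)
  have hx := height_sq (spatial x)
  rw [height_spatial] at hμ hx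
  have hμ0 := μ.2.2
  have hx0 := x.2.2
  have hn : ‖spatial μ‖ ≤ μ.1 0 := abs_le_of_sq_le_sq' (by linarith) hμ0.le |>.2
  rw [div_le_iff₀ (by positivity), lor, ← h1]
  have h2 : μ.1 0 * (x.1 0 - ‖spatial x‖) ≤
      -(-(μ.1 0 * x.1 0) + inner ℝ (spatial μ) (spatial x)) := by
    nlinarith [norm_nonneg (spatial x), norm_nonneg (spatial μ)]
  have hxn : ‖spatial x‖ ≤ x.1 0 := abs_le_of_sq_le_sq' (by linarith) hx0.le |>.2
  have h3 : 1 ≤ (x.1 0 - ‖spatial x‖) * (2 * x.1 0) := by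
    nlinarith [sq_nonneg (x.1 0 - ‖spatial x‖)]
  calc μ.1 0 ≤ μ.1 0 * ((x.1 0 - ‖spatial x‖) * (2 * x.1 0)) := le_mul_of_one_le_right hμ0.le h3
    _ = μ.1 0 * (x.1 0 - ‖spatial x‖) * (2 * x.1 0) := by ring
    _ ≤ _ := mul_le_mul_of_nonneg_right h2 (by positivity)

/-- Outside a compact set of base points, the squared distance is bounded below by an integrable
function of arbitrarily large expectation. -/
theorem exists_minorant_rho_sq (Q : Measure (Hyp d)) [IsProbabilityMeasure Q] (a : ℝ) :
    ∃ R : ℝ, ∃ h : Hyp d → ℝ, Measurable h ∧ Integrable h Q ∧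
      (∀ μ : Hyp d, R < μ.1 0 → ∀ x, h x ≤ rho μ x ^ 2) ∧ a < ∫ x, h x ∂Q := by
  have htime : Measurable fun x : Hyp d => x.1 0 :=
    (measurable_pi_apply 0).comp measurable_subtype_coe
  obtain ⟨r, hr⟩ : ∃ r : ℕ, 0 < Q {x | x.1 0 ≤ r} := by
    by_contra! hcon
    have hU : ⋃ r : ℕ, {x : Hyp d | x.1 0 ≤ r} = Set.univ := by
      ext x
      simpa using exists_nat_ge (x.1 0)
    have h0 : Q (⋃ r : ℕ, {x : Hyp d | x.1 0 ≤ r}) = 0 :=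
      measure_iUnion_null fun r => le_antisymm (hcon r) (zero_le)
    rw [hU, measure_univ] at h0
    exact one_ne_zero h0
  set s : Set (Hyp d) := {x | x.1 0 ≤ r} with hs
  have hsm : MeasurableSet s := measurableSet_le htime measurable_const
  have hsr : 0 < Q.real s := ENNReal.toReal_pos hr.ne' (measure_ne_top _ _)
  -- `A` makes the integral of `A` over `s` equal to `|a| + 1 > a`. The threshold `cosh √A * (2 r)`
  -- below forces `ρ² ≥ A` on `s`.
  set A : ℝ := (|a| + 1) / Q.real s with hA
  have hA0 : 0 ≤ A := by positivity
  refine ⟨Real.cosh √A * (2 * r), s.indicator fun _ => A, measurable_const.indicator hsm,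
    (integrable_const A).indicator hsm, fun μ hμ x => ?_, ?_⟩
  · by_cases hx : x ∈ s
    · rw [Set.indicator_of_mem hx]
      have hx0 := x.2.2
      have h1 : Real.cosh √A ≤ Real.cosh (rho μ x) := by
        rw [cosh_rho]
        refine le_trans ?_ (time_div_le_neg_lor μ x)
        rw [le_div_iff₀ (by positivity)]
        refine le_trans ?_ hμ.le
        have : x.1 0 ≤ r := hx
        gcongr
      rw [Real.cosh_le_cosh, abs_of_nonneg (Real.sqrt_nonneg _), abs_of_nonneg (rho_nonneg _ _)] at h1
      exact (Real.sqrt_le_left (rho_nonneg _ _)).1 h1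
    · rw [Set.indicator_of_notMem hx]
      positivity
  · rw [integral_indicator_const _ hsm, hA, smul_eq_mul, mul_div_cancel₀ _ hsr.ne']
    linarith [le_abs_self a]

end Infinity

/-! ### Assembly of the consistency theorem -/

/-- Strong consistency of shell-constrained maximum likelihood estimators. -/
theorem ae_tendsto_of_isShellMLE {d : ℕ} (hd : 1 ≤ d) {lo hi : ℝ} (hlo : 0 < lo) (hlohi : lo < hi)
    {Ω : Type*} [MeasurableSpace Ω] (P : Measure Ω) (μ₀ : Hyp d) (S₀ : SPD d)
    (hS₀ : S₀ ∈ shell d lo hi) (X : ℕ → Ω → Hyp d) (hindep : iIndepFun X P)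
    (hlaw : ∀ i, HasLaw (X i) (hwn μ₀ S₀) P) :
    ∀ᵐ ω ∂P, ∀ θhat : ℕ → Hyp d × SPD d,
      (∀ n, 1 ≤ n → IsShellMLE lo hi (fun i : Fin n => X i ω) (θhat n)) →
      Tendsto θhat atTop (𝓝 (μ₀, S₀)) := by
  obtain ⟨C, hC⟩ := exists_logDensity_le (d := d) hlo hlohi hd
  have hhi : 0 < hi := hlo.trans hlohi
  let θ₀ : Hyp d × shell d lo hi := (μ₀, ⟨S₀, hS₀⟩)
  let e : Hyp d × shell d lo hi → Hyp d × SPD d := fun θ => (θ.1, θ.2.1)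
  have he : Continuous e := continuous_fst.prodMk (continuous_subtype_val.comp continuous_snd)
  have hei : Function.Injective e := fun a b hab => by
    have h1 := congrArg Prod.fst hab
    have h2 := congrArg Prod.snd hab
    exact Prod.ext h1 (Subtype.ext h2)
  let g : Hyp d × shell d lo hi → Hyp d → ℝ := fun θ x => C - logDensity (e θ) x
  have hlow : ∀ θ x, rho θ.1 x ^ 2 / (2 * hi) ≤ g θ x := fun θ x => by
    have := hC θ.1 θ.2.1 θ.2.2 x
    change _ ≤ C - logDensity (θ.1, θ.2.1) x
    linarith
  have hle : ∀ θ x, logDensity (e θ) x ≤ C := fun θ x => by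
    have h1 := hlow θ x
    have h2 : 0 ≤ rho θ.1 x ^ 2 / (2 * hi) := by positivity
    change _ ≤ C - logDensity (e θ) x at h1
    linarith
  have hgx : ∀ θ, Continuous (g θ) := fun θ =>
    continuous_const.sub (continuous_logDensity_right (e θ))
  have hgθ : ∀ x, Continuous fun θ => g θ x := fun x => by
    have := continuous_logDensity.comp (he.prodMk (continuous_const (y := x)))
    exact continuous_const.sub this
  have hm₀ : Integrable (logDensity (μ₀, S₀)) (hwn μ₀ S₀) := integrable_logDensity (μ₀, S₀)
  have hi₀ : Integrable (g θ₀) (hwn μ₀ S₀) := (integrable_const C).sub hm₀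
  have hsep : ∀ θ, θ ≠ θ₀ → ∫⁻ x, ENNReal.ofReal (g θ₀ x) ∂(hwn μ₀ S₀) <
      ∫⁻ x, ENNReal.ofReal (g θ x) ∂(hwn μ₀ S₀) := by
    intro θ hne
    by_contra! hcon
    -- The equality case of Gibbs' inequality, followed by identifiability.
    exact hne (hei (eq_of_logDensity_ae_eq (θ := e θ) (θ₀ := (μ₀, S₀)) hd
      (ae_eq_of_lintegral_sub_le (continuous_logDensity_right _).measurable (hle θ) hm₀ (hle θ₀)
        (lintegral_likelihood_ratio hd (e θ) (μ₀, S₀)).le hcon)))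
  obtain ⟨R, h, hm, hint, hR, hlt⟩ :=
    exists_minorant_rho_sq (hwn μ₀ S₀) ((∫ x, g θ₀ x ∂(hwn μ₀ S₀)) * (2 * hi))
  have : CompactSpace (shell d lo hi) := isCompact_iff_compactSpace.1 (isCompact_shell hlo)
  have : SecondCountableTopology (Matrix (Fin d) (Fin d) ℝ) :=
    inferInstanceAs (SecondCountableTopology (Fin d → Fin d → ℝ))
  have : SecondCountableTopology (shell d lo hi) :=
    (Topology.IsEmbedding.subtypeVal.comp Topology.IsEmbedding.subtypeVal).secondCountableTopology
  have : SecondCountableTopology (Hyp d) :=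
    Topology.IsEmbedding.subtypeVal.secondCountableTopology
  have : SecondCountableTopology (Hyp d × shell d lo hi) := inferInstance
  have hwald := tendsto_of_minimizes_contrast hindep hlaw
    (fun θ x => sub_nonneg.2 (hle θ x)) hgx hgθ hi₀ hsep
    ((isCompact_setOf_time_le (d := d) R).prod (isCompact_univ (X := shell d lo hi)))
    (h := fun x => h x / (2 * hi)) (hm.div_const _) (hint.div_const _)
    (fun θ hθ x => by
      refine le_trans ?_ (hlow θ x)
      have hθ' : R < θ.1.1 0 := by
        by_contra! hcon
        exact hθ ⟨hcon, Set.mem_univ _⟩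
      exact div_le_div_of_nonneg_right (hR θ.1 hθ' x) (by positivity))
    (by rwa [integral_div, lt_div_iff₀ (by positivity)])
  filter_upwards [hwald] with ω hω θhat hmle
  -- The empty sample `n = 0` carries no shell constraint, so `θ₀` serves as a filler; only the tail
  -- matters.
  let θ' : ℕ → Hyp d × shell d lo hi := fun n =>
    if hn : 1 ≤ n then ((θhat n).1, ⟨(θhat n).2, (hmle n hn).1⟩) else θ₀
  have hθ' : ∀ n, 1 ≤ n → e (θ' n) = θhat n := fun n hn => by
    simp only [θ', e, dif_pos hn]
  have hconv : Tendsto θ' atTop (𝓝 θ₀) := by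
    refine hω θ' ?_
    filter_upwards [eventually_ge_atTop 1] with n hn
    have h1 := (hmle n hn).2 (μ₀, S₀) hS₀
    simp only [logLik] at h1
    rw [Fin.sum_univ_eq_sum_range (fun i => logDensity (μ₀, S₀) (X i ω)),
      Fin.sum_univ_eq_sum_range (fun i => logDensity (θhat n) (X i ω))] at h1
    simp only [hθ' n hn, Finset.sum_sub_distrib]
    exact sub_le_sub_left h1 _
  refine ((he.tendsto θ₀).comp hconv).congr' ?_
  filter_upwards [eventually_ge_atTop 1] with n hn using hθ' n hn

end HWN

theorem mainTheorem1 {d : ℕ} (hd : 2 ≤ d) {lo hi : ℝ} (hlo : 0 < lo) (hlohi : lo < hi)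
    {Ω : Type*} [MeasurableSpace Ω] (P : Measure Ω) [IsProbabilityMeasure P]
    (μ₀ : HWN.Hyp d) (S₀ : HWN.SPD d) (hS₀ : S₀ ∈ interior (HWN.shell d lo hi))
    (X : ℕ → Ω → HWN.Hyp d) (hindep : iIndepFun X P)
    (hlaw : ∀ i, HasLaw (X i) (HWN.hwn μ₀ S₀) P)
    (μhat : ℕ → Ω → HWN.Hyp d) (Shat : ℕ → Ω → HWN.SPD d)
    (hμmeas : ∀ n, 1 ≤ n → Measurable (μhat n)) (hSmeas : ∀ n, 1 ≤ n → Measurable (Shat n))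
    (hmax : ∀ n, 1 ≤ n → ∀ᵐ ω ∂P,
      HWN.IsShellMLE lo hi (fun i : Fin n => X i ω) (μhat n ω, Shat n ω)) :
    (∀ᵐ ω ∂P, Tendsto (fun n => μhat n ω) atTop (𝓝 μ₀) ∧
        Tendsto (fun n => Shat n ω) atTop (𝓝 S₀)) ∧
      ∀ᵐ ω ∂P, Tendsto (fun n => HWN.chart μ₀ (μhat n ω, Shat n ω)) atTop
        (𝓝 (0, HWN.vech (cfc Real.log S₀.1))) := by
  have hS₀' := interior_subset hS₀
  have hmle : ∀ᵐ ω ∂P, ∀ n, 1 ≤ n →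
      HWN.IsShellMLE lo hi (fun i : Fin n => X i ω) (μhat n ω, Shat n ω) :=
    ae_all_iff.2 fun n => ae_all_iff.2 fun hn => hmax n hn
  have hconv : ∀ᵐ ω ∂P, Tendsto (fun n => μhat n ω) atTop (𝓝 μ₀) ∧
      Tendsto (fun n => Shat n ω) atTop (𝓝 S₀) := by
    filter_upwards [hmle, HWN.ae_tendsto_of_isShellMLE (by lia) hlo hlohi P μ₀ S₀ hS₀' X hindep hlaw]
      with ω h1 h2
    exact Prod.tendsto_iff _ _ |>.1 (h2 (fun n => (μhat n ω, Shat n ω)) h1)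
  refine ⟨hconv, ?_⟩
  filter_upwards [hconv, hmle] with ω hω h1
  refine Tendsto.prodMk_nhds ?_ ?_
  · have h2 : Continuous fun x => HWN.tcoord μ₀ x := by
      have := HWN.continuous_tcoord.comp (Continuous.prodMk_right (X := HWN.Hyp d) μ₀)
      exact this
    have := (h2.tendsto μ₀).comp hω.1
    rwa [HWN.tcoord_self] at this
  · have h2 : Tendsto (fun n => cfc Real.log (Shat n ω).1) atTop (𝓝 (cfc Real.log S₀.1)) :=
      HWN.tendsto_cfc_log hlo
        ((eventually_ge_atTop 1).mono fun n hn => (h1 n hn).1) hS₀' hω.2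
    have h3 : Continuous fun A : Matrix (Fin d) (Fin d) ℝ => HWN.vech A :=
      continuous_pi fun p => continuous_id.matrix_elem p.1.1 p.1.2
    exact (h3.tendsto _).comp h2
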